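/- Let $L\ge 2$ be an integer and let $\mathbb{H}_L=\bigoplus_{i=1}^\infty \mathbb{Z}/L\mathbb{Z}$ be the one-dimensional hierarchical lattice with the ultrametric $\|x-y\| = L^{\max\{i : x_i\neq y_i\}}$ for $x\neq y$ (and $\|x-x\|=0$). For $n\ge 0$ let $\Lambda_n=\{x\in\mathbb{H}_L : \|x\|\le L^n\}$. Let $E=\{\{x,y\}: x,y\in \mathbb{H}_L,\ x\ne y\}$, put $|e|=\|x-y\|$ for $e=\{x,y\}\in E$, and let $J:E\to[0,\infty)$ be a kernel; write $J(x,y)=J(\{x,y\})$ if $x\neq y$ and $J(x,x)=0$. Suppose that $J$ is - isometry-invariant: $J(e)=J(f)$ for all $e,f\in E$ with $|e|=|f|$; - integrable: $\sum_{e\in E:\,0\in e}J(e)<\infty$; - regular: there is a constant $C<\infty$ such that $\sum_{x\notin\Lambda_n}J(0,x)\le C\sum_{x\in\Lambda_{n+1}\setminus\Lambda_n}J(0,x)$ for all large enough $n$. Let $\mathbb{P}_J$ be the law of the random graph with vertex set $\mathbb{H}_L$ in which each $e\in E$ is open with probability $1-\exp(-J(e))$, independently of all other edges. Let $K_0$ be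 the open cluster of $0$, and let $\theta=\mathbb{P}_J(|K_0|=\infty)$. For finite $A\subseteq\mathbb{H}_L$ and $x\in A$ let $K_x(A)$ be the set of all $y\in A$ that are connected to $x$ by an open path inside $A$, and let $|K_{\max}(A)|=\max_{x\in A}|K_x(A)|$. If $\theta>0$, then for every $\varepsilon>0$ $$\mathbb{P}_J\bigl(|K_{\max}(\Lambda_n)|\ge(\theta-\varepsilon)|\Lambda_n|\bigr)\longrightarrow 1\qquad\text{as } n\to\infty.$$ -/

import Mathlib

open MeasureTheory ProbabilityTheory Filter Topology
open scoped NNReal ENNReal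

noncomputable section

namespace HierPerc

/-- The one-dimensional hierarchical lattice `⨁_{i ≥ 1} ℤ/Lℤ`. The coordinate written `i ≥ 1` in
the mathematical notation is the coordinate `i - 1 : ℕ` here. -/
abbrev Lattice (L : ℕ) : Type := ℕ →₀ ZMod L

variable {L : ℕ}

/-- `max {i ≥ 1 : x_i ≠ y_i}`, where coordinates are counted from `1` (and `0` if `x = y`). -/
def level (x y : Lattice L) : ℕ := (x - y).support.sup fun i => i + 1

/-- The ultrametric `‖x - y‖ = L ^ max {i : x_i ≠ y_i}` for `x ≠ y`, and `0` for `x = y`. -/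
def hdist (x y : Lattice L) : ℝ :=
  open Classical in if x = y then 0 else (L : ℝ) ^ level x y

theorem hdist_comm (x y : Lattice L) : hdist x y = hdist y x := by
  have h : level x y = level y x := by
    unfold level
    rw [← neg_sub y x, Finsupp.support_neg]
  unfold hdist
  rw [h]
  simp only [eq_comm]

/-- The `n`-block `Λ_n(x)`: the ultrametric ball of radius `L ^ n` around `x`. -/
def blockAt (n : ℕ) (x : Lattice L) : Set (Lattice L) := {y | hdist x y ≤ (L : ℝ) ^ n}

variable (L) in
/-- The `n`-block `Λ_n` containing the origin. -/
def block (n : ℕ) : Set (Lattice L) := blockAt n 0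

variable (L) in
/-- The edge set: all unordered pairs `{x, y}` with `x ≠ y`. -/
abbrev Edge : Type := {e : Sym2 (Lattice L) // ¬ e.IsDiag}

/-- The edge `{x, y}`. -/
def mkEdge (x y : Lattice L) (h : x ≠ y) : Edge L := ⟨s(x, y), fun hd => h (Sym2.mk_isDiag_iff.1 hd)⟩

/-- The length `|e| = ‖x - y‖` of the edge `e = {x, y}`. -/
def edgeLength (e : Edge L) : ℝ := Sym2.lift ⟨hdist, hdist_comm⟩ e.1

/-- A kernel assigns a nonnegative weight to every edge. -/
abbrev Kernel (L : ℕ) : Type := Edge L → ℝ≥0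

/-- `J(x, y) = 1(x ≠ y) J({x, y})`. -/
def Kernel.pair (J : Kernel L) (x y : Lattice L) : ℝ≥0 :=
  open Classical in if h : x = y then 0 else J (mkEdge x y h)

/-- `J(e) = J(f)` whenever `|e| = |f|`. -/
def Kernel.IsometryInvariant (J : Kernel L) : Prop :=
  ∀ e f : Edge L, edgeLength e = edgeLength f → J e = J f

/-- `∑_{e ∋ 0} J(e) < ∞`. -/
def Kernel.IsIntegrable (J : Kernel L) : Prop :=
  ∑' e : {e : Edge L // (0 : Lattice L) ∈ e.1}, (J e.1 : ℝ≥0∞) < ∞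

/-- There is a constant `C` such that, for all large `n`,
`∑_{x ∉ Λ_n} J(0, x) ≤ C ∑_{x ∈ Λ_{n+1} \ Λ_n} J(0, x)`. -/
def Kernel.IsRegular (J : Kernel L) : Prop :=
  ∃ C : ℝ≥0, ∀ᶠ n : ℕ in atTop,
    ∑' x : {x : Lattice L // x ∉ block L n}, (J.pair 0 x.1 : ℝ≥0∞) ≤
      C * ∑' x : {x : Lattice L // x ∈ block L (n + 1) \ block L n}, (J.pair 0 x.1 : ℝ≥0∞)

/-- A percolation configuration: `ω e = true` means that the edge `e` is open. -/
abbrev Config (L : ℕ) : Type := Edge L → Bool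

/-- The probability `1 - exp (-J(e))` that `e` is open. -/
def Kernel.openProb (J : Kernel L) (e : Edge L) : unitInterval :=
  ⟨1 - Real.exp (-(J e : ℝ)), by
    have h1 : Real.exp (-(J e : ℝ)) ≤ 1 := Real.exp_le_one_iff.2 (neg_nonpos.2 (J e).2)
    have h0 := Real.exp_pos (-(J e : ℝ))
    constructor <;> linarith⟩

/-- The law `ℙ_J`: edges are open independently of each other, `e` with probability
`1 - exp (-J(e))`. -/
def Kernel.law (J : Kernel L) : Measure (Config L) :=
  Measure.infinitePi fun e => bernoulliMeasure true false (J.openProb e)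

/-- The random graph whose edges are the open edges. -/
def openGraph (ω : Config L) : SimpleGraph (Lattice L) where
  Adj x y := ∃ h : x ≠ y, ω (mkEdge x y h) = true
  symm := ⟨by
    rintro x y ⟨h, hω⟩
    refine ⟨h.symm, ?_⟩
    have : mkEdge y x h.symm = mkEdge x y h := Subtype.ext Sym2.eq_swap
    rw [this]
    exact hω⟩
  loopless := ⟨fun _ h => h.1 rfl⟩

/-- The open cluster `K_x` of `x`. -/
def cluster (ω : Config L) (x : Lattice L) : Set (Lattice L) :=
  {y | (openGraph ω).Reachable x y}

/-- The cluster `K_x(A)` of `x` in `A`: all `y ∈ A` connected to `x ∈ A` by an open path that stays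
inside `A`. -/
def clusterIn (ω : Config L) (A : Set (Lattice L)) (x : A) : Set (Lattice L) :=
  {y | ∃ hy : y ∈ A, ((openGraph ω).induce A).Reachable x ⟨y, hy⟩}

/-- `|K_max(A)| = max_{x ∈ A} |K_x(A)|`, for a finite set `A` of vertices. -/
def maxClusterSize (ω : Config L) (A : Set (Lattice L)) : ℕ :=
  ⨆ x : A, (clusterIn ω A x).ncard

/-- The infinite cluster density `θ = ℙ_J(|K_0| = ∞)`. -/
def Kernel.theta (J : Kernel L) : ℝ := J.law.real {ω | (cluster ω 0).Infinite}

end HierPerc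

end

/-! Write T_n for the total weight `J.tail n` from a vertex to the outside of its n-block, and w_n
for the weight `J.weight n` of an edge of length L^(n+1). Fix M, and call a vertex heavy if its
cluster K inside its n-block satisfies |K| T_n > M, light otherwise.

Heavy vertices abound. Given a light cluster, with probability at least e^(-M) no open edge leaves
its block from it, and then it is a full cluster of the percolation. So a vertex is light with at
least k vertices in its n-block cluster with probability at most e^M P(k ≤ |K_0| < ∞), which is
small for large k (`law_light_cluster_le`). For fixed m, the fraction of vertices of an n-block
whose m-block cluster has at least k vertices concentrates, since different m-blocks are independent
(`law_card_large_le`); for m large its mean is nearly θ or more. Hence nearly a fraction θ of each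
n-block is heavy (`eventually_law_card_heavy_lt_le`). In particular L^n T_n → ∞, since otherwise no
cluster could be heavy.

Heavy clusters merge one scale up. The n-blocks of Λ_(n+1) contain at most L^(n+1) T_n / M heavy
clusters. If no cluster in Λ_(n+1) has size at least the number of heavy vertices minus c = η L^n,
the heavy clusters split into two classes, each with at least c vertices and with no open edge
between them (`exists_balanced_saturated`). As every n-block is rich in heavy vertices, at least
(c/L)^2 pairs across the split lie in different n-blocks (`sq_le_card_crossPairs`). Their edges have
weight w_n and are independent of the n-block clusters, so a union bound over splittings gives
probability at most exp(L^(n+1) T_n / M - w_n (c/L)^2) (`law_closedCut_le`). Regularity yields T_n ≤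
C L^(n+1) w_n, so for M large the exponent is at most a negative multiple of L^n T_n and tends to
-∞. -/

noncomputable section

namespace HierPerc

/-! ### Blocks and clusters of the hierarchical lattice -/

section Lattice

variable {L : ℕ}

/-- `x` and `y` lie in the same `n`-block: all coordinates from index `n` on agree. -/
def Near (n : ℕ) (x y : Lattice L) : Prop := ∀ i, n ≤ i → x i = y i

theorem Near.refl (n : ℕ) (x : Lattice L) : Near n x x := fun _ _ => rfl

theorem Near.symm {n : ℕ} {x y : Lattice L} (h : Near n x y) : Near n y x :=
  fun i hi => (h i hi).symm

theorem Near.trans {n : ℕ} {x y z : Lattice L} (h : Near n x y) (h' : Near n y z) : Near n x z :=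
  fun i hi => (h i hi).trans (h' i hi)

theorem Near.mono {m n : ℕ} (hmn : m ≤ n) {x y : Lattice L} (h : Near m x y) : Near n x y :=
  fun i hi => h i (hmn.trans hi)

theorem near_add_right {n : ℕ} {x y : Lattice L} (z : Lattice L) :
    Near n (x + z) (y + z) ↔ Near n x y := by
  simp [Near]

theorem exists_near (x y : Lattice L) : ∃ n, Near n x y := by
  refine ⟨(x - y).support.sup (fun i => i + 1), fun i hi => ?_⟩
  by_contra h
  have : i ∈ (x - y).support := by simpa [sub_eq_zero] using h
  have := Finset.le_sup (f := fun i => i + 1) this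
  omega

theorem level_le_iff {n : ℕ} {x y : Lattice L} : level x y ≤ n ↔ Near n x y := by
  unfold level Near
  rw [Finset.sup_le_iff]
  constructor
  · intro h i hi
    by_contra hne
    have := h i (by simpa [sub_eq_zero] using hne)
    omega
  · intro h i hi
    by_contra hlt
    simp only [Finsupp.mem_support_iff, Finsupp.coe_sub, Pi.sub_apply, sub_ne_zero] at hi
    exact hi (h i (by omega))

theorem mem_blockAt_iff (hL : 2 ≤ L) {n : ℕ} {x y : Lattice L} :
    y ∈ blockAt n x ↔ Near n x y := by
  unfold blockAt hdist
  have hL1 : (1 : ℝ) < L := by exact_mod_cast hL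
  rw [Set.mem_ofPred_eq]
  split_ifs with h
  · subst h
    exact ⟨fun _ => Near.refl _ _, fun _ => by positivity⟩
  · rw [pow_le_pow_iff_right₀ hL1, level_le_iff]

theorem mem_block_iff (hL : 2 ≤ L) {n : ℕ} {y : Lattice L} :
    y ∈ block L n ↔ Near n 0 y := mem_blockAt_iff hL

/-- Restricting to the first `n` coordinates identifies an `n`-block with `Fin n → ZMod L`. -/
def blockEquiv (n : ℕ) (x : Lattice L) : {y // Near n x y} ≃ (Fin n → ZMod L) :=
  Equiv.ofBijective (fun y i => y.1 i) (by
    constructor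
    · rintro ⟨y, hy⟩ ⟨y', hy'⟩ h
      refine Subtype.ext (Finsupp.ext fun i => ?_)
      by_cases hi : i < n
      · exact congrFun h ⟨i, hi⟩
      · exact (hy i (by omega)).symm.trans (hy' i (by omega))
    · intro f
      refine ⟨⟨Finsupp.onFinset (x.support ∪ Finset.range n)
        (fun i => if h : i < n then f ⟨i, h⟩ else x i) ?_, ?_⟩, ?_⟩
      · intro i hi
        by_cases h : i < n
        · simp [h]
        · simp [h] at hi
          simp [hi]
      · intro i hi
        simp [not_lt.2 hi]
      · funext i
        simp)

section Finite

variable [NeZero L]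

theorem finite_near (n : ℕ) (x : Lattice L) : {y | Near n x y}.Finite :=
  Set.finite_coe_iff.1 (Finite.of_equiv (Fin n → ZMod L) (blockEquiv n x).symm)

/-- The `n`-block of `x` as a finset. -/
def box (n : ℕ) (x : Lattice L) : Finset (Lattice L) := (finite_near n x).toFinset

@[simp] theorem mem_box {n : ℕ} {x y : Lattice L} : y ∈ box n x ↔ Near n x y := by
  simp [box]

theorem card_box (n : ℕ) (x : Lattice L) : (box n x).card = L ^ n := by
  have h1 : Nat.card {y // Near n x y} = L ^ n := by
    rw [Nat.card_congr (blockEquiv n x)]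
    simp
  rw [← h1, box, ← Set.ncard_eq_toFinset_card _ (finite_near n x)]
  rfl

theorem coe_box (hL : 2 ≤ L) (n : ℕ) : (box n (0 : Lattice L) : Set (Lattice L)) = block L n := by
  ext y
  simp [mem_block_iff hL]

theorem ncard_block (hL : 2 ≤ L) (n : ℕ) : (block L n).ncard = L ^ n := by
  rw [← coe_box hL, Set.ncard_coe_finset, card_box]

end Finite

/-- The open edges of length at most `L ^ n`. -/
def shortGraph (n : ℕ) (ω : Config L) : SimpleGraph (Lattice L) where
  Adj x y := (openGraph ω).Adj x y ∧ Near n x y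
  symm := ⟨fun x y (h : (openGraph ω).Adj x y ∧ Near n x y) => ⟨h.1.symm, h.2.symm⟩⟩
  loopless := ⟨fun x (h : (openGraph ω).Adj x x ∧ Near n x x) => (openGraph ω).loopless.irrefl x h.1⟩

theorem shortGraph_mono {m n : ℕ} (hmn : m ≤ n) (ω : Config L) :
    shortGraph m ω ≤ shortGraph n ω := by
  intro x y h
  exact ⟨h.1, h.2.mono hmn⟩

theorem near_of_reachable {n : ℕ} {ω : Config L} {x y : Lattice L}
    (h : (shortGraph n ω).Reachable x y) : Near n x y := by
  rw [SimpleGraph.reachable_iff_reflTransGen] at h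
  induction h with
  | refl => exact Near.refl _ _
  | tail _ h ih => exact ih.trans h.2

theorem reachable_openGraph {n : ℕ} {ω : Config L} {x y : Lattice L}
    (h : (shortGraph n ω).Reachable x y) : (openGraph ω).Reachable x y :=
  h.mono (by intro _ _ h; exact h.1)

theorem exists_reachable_shortGraph {ω : Config L} {x y : Lattice L}
    (h : (openGraph ω).Reachable x y) : ∃ n, (shortGraph n ω).Reachable x y := by
  rw [SimpleGraph.reachable_iff_reflTransGen] at h
  induction h with
  | refl => exact ⟨0, SimpleGraph.Reachable.refl _⟩
  | @tail b c _ h ih =>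
    obtain ⟨n, hn⟩ := ih
    obtain ⟨m, hm⟩ := exists_near b c
    refine ⟨max n m, (hn.mono (shortGraph_mono (le_max_left n m) ω)).trans ?_⟩
    exact SimpleGraph.Adj.reachable ⟨h, hm.mono (le_max_right n m)⟩

section Cluster

variable [NeZero L]

open Classical in
/-- The cluster of `x` inside its `n`-block. -/
def cl (n : ℕ) (ω : Config L) (x : Lattice L) : Finset (Lattice L) :=
  (box n x).filter fun y => (shortGraph n ω).Reachable x y

theorem mem_cl {n : ℕ} {ω : Config L} {x y : Lattice L} :
    y ∈ cl n ω x ↔ (shortGraph n ω).Reachable x y := by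
  classical
  simp only [cl, Finset.mem_filter, mem_box, and_iff_right_iff_imp]
  exact near_of_reachable

theorem self_mem_cl (n : ℕ) (ω : Config L) (x : Lattice L) : x ∈ cl n ω x :=
  mem_cl.2 (SimpleGraph.Reachable.refl _)

theorem cl_subset_box (n : ℕ) (ω : Config L) (x : Lattice L) : cl n ω x ⊆ box n x :=
  fun _ h => mem_box.2 (near_of_reachable (mem_cl.1 h))

theorem cl_mono {m n : ℕ} (hmn : m ≤ n) (ω : Config L) (x : Lattice L) : cl m ω x ⊆ cl n ω x :=
  fun _ h => mem_cl.2 ((mem_cl.1 h).mono (shortGraph_mono hmn ω))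

theorem cl_eq_of_reachable {n : ℕ} {ω : Config L} {x y : Lattice L}
    (h : (shortGraph n ω).Reachable x y) : cl n ω x = cl n ω y := by
  ext z
  simp only [mem_cl]
  exact ⟨fun h' => h.symm.trans h', fun h' => h.trans h'⟩

theorem coe_cl_subset_cluster (n : ℕ) (ω : Config L) (x : Lattice L) :
    (cl n ω x : Set (Lattice L)) ⊆ cluster ω x :=
  fun _ h => reachable_openGraph (mem_cl.1 h)

theorem cluster_eq_iUnion (ω : Config L) (x : Lattice L) :
    cluster ω x = ⋃ n, (cl n ω x : Set (Lattice L)) := by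
  ext y
  simp only [Set.mem_iUnion, Finset.mem_coe, mem_cl]
  exact ⟨exists_reachable_shortGraph, fun ⟨_, h⟩ => reachable_openGraph h⟩

/-- By the ultrametric inequality a path of edges of length at most L^n cannot leave its n-block. So
`shortGraph n` describes the clusters inside all n-blocks at once, without induced subgraphs. -/
theorem clusterIn_block (hL : 2 ≤ L) (n : ℕ) (ω : Config L) (x : block L n) :
    clusterIn ω (block L n) x = cl n ω x := by
  ext y
  simp only [clusterIn, Set.mem_ofPred_eq, Finset.mem_coe, mem_cl]
  constructor
  · rintro ⟨hy, h⟩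
    refine h.map (⟨Subtype.val, ?_⟩ : (openGraph ω).induce (block L n) →g shortGraph n ω)
    intro a b hab
    exact ⟨hab, ((mem_block_iff hL).1 a.2).symm.trans ((mem_block_iff hL).1 b.2)⟩
  · intro h
    rw [SimpleGraph.reachable_iff_reflTransGen] at h
    induction h with
    | refl => exact ⟨x.2, SimpleGraph.Reachable.refl _⟩
    | @tail b c _ h ih =>
      obtain ⟨hb, hr⟩ := ih
      have hc : c ∈ block L n := (mem_block_iff hL).2 (((mem_block_iff hL).1 hb).trans h.2)
      refine ⟨hc, hr.trans (SimpleGraph.Adj.reachable ?_)⟩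
      exact h.1

theorem card_cl_le_maxClusterSize (hL : 2 ≤ L) {n : ℕ} (ω : Config L) {x : Lattice L}
    (hx : Near n 0 x) : (cl n ω x).card ≤ maxClusterSize ω (block L n) := by
  have hx' : x ∈ block L n := (mem_block_iff hL).2 hx
  have hbdd : BddAbove (Set.range fun x : block L n => (clusterIn ω (block L n) x).ncard) := by
    refine ⟨L ^ n, ?_⟩
    rintro _ ⟨y, rfl⟩
    simp only [clusterIn_block hL, Set.ncard_coe_finset]
    exact (Finset.card_le_card (cl_subset_box n ω y)).trans (card_box n _).le
  have := le_ciSup hbdd ⟨x, hx'⟩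
  simpa only [clusterIn_block hL, Set.ncard_coe_finset, maxClusterSize] using this

end Cluster

end Lattice

/-! ### Independence, closed edge sets and translation invariance -/

section Law

variable {L : ℕ}

instance (J : Kernel L) : IsProbabilityMeasure J.law := by
  unfold Kernel.law
  infer_instance

instance : Countable (Edge L) := by
  have : Countable (ZMod L) := by
    cases L
    · exact inferInstanceAs (Countable ℤ)
    · infer_instance
  have : Countable (Sym2 (Lattice L)) := Quot.mk_surjective.countable
  infer_instance

/-- The `σ`-algebra generated by the states of the edges in `S`. -/
abbrev edgeSigma (S : Set (Edge L)) : MeasurableSpace (Config L) :=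
  ⨆ e ∈ S, MeasurableSpace.comap (fun ω : Config L => ω e) ⊤

theorem edgeSigma_le (S : Set (Edge L)) :
    edgeSigma S ≤ (inferInstance : MeasurableSpace (Config L)) :=
  iSup₂_le fun e _ => (measurable_pi_apply e).comap_le

theorem indep_edgeSigma (J : Kernel L) {S T : Set (Edge L)} (h : Disjoint S T) :
    Indep (edgeSigma S) (edgeSigma T) J.law := by
  have hi : iIndepFun (fun (e : Edge L) (ω : Config L) => ω e) J.law :=
    iIndepFun_infinitePi (X := fun _ b => b) (fun _ => measurable_id)
  exact indep_iSup_of_disjoint (fun e => (measurable_pi_apply e).comap_le) hi h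

theorem law_real_inter (J : Kernel L) {S T : Set (Edge L)} (h : Disjoint S T)
    {A B : Set (Config L)} (hA : MeasurableSet[edgeSigma S] A)
    (hB : MeasurableSet[edgeSigma T] B) :
    J.law.real (A ∩ B) = J.law.real A * J.law.real B := by
  rw [measureReal_def, (Indep_iff _ _ _).1 (indep_edgeSigma J h) A B hA hB, ENNReal.toReal_mul]
  rfl

theorem measurableSet_edge {S : Set (Edge L)} {e : Edge L} (he : e ∈ S) (b : Bool) :
    MeasurableSet[edgeSigma S] {ω : Config L | ω e = b} := by
  have h : MeasurableSpace.comap (fun ω : Config L => ω e) ⊤ ≤ edgeSigma S :=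
    le_iSup₂_of_le e he le_rfl
  exact h _ ⟨{b}, trivial, rfl⟩

theorem measurableSet_of_determined {S : Set (Edge L)} (hS : S.Finite) {A : Set (Config L)}
    (hA : ∀ ω ω' : Config L, (∀ e ∈ S, ω e = ω' e) → ω ∈ A → ω' ∈ A) :
    MeasurableSet[edgeSigma S] A := by
  have : Finite S := hS
  -- A is a union of cylinders, one for each of the finitely many patterns on S that A realizes.
  have hE : A = ⋃ f ∈ {f : S → Bool | ∃ ω ∈ A, ∀ e : S, ω e = f e},
      ⋂ e : S, {ω : Config L | ω e = f e} := by
    ext ω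
    simp only [Set.mem_iUnion, Set.mem_iInter, Set.mem_ofPred_eq]
    constructor
    · intro h
      exact ⟨fun e => ω e, ⟨ω, h, fun _ => rfl⟩, fun _ => rfl⟩
    · rintro ⟨f, ⟨ω', h', hf'⟩, hf⟩
      exact hA ω' ω (fun e he => (hf' ⟨e, he⟩).trans (hf ⟨e, he⟩).symm) h'
  rw [hE]
  refine MeasurableSet.biUnion (Set.to_countable _) fun f _ => ?_
  exact MeasurableSet.iInter fun e => measurableSet_edge e.2 _

/-- All the edges of `F` are closed. -/
def allClosed (F : Set (Edge L)) : Set (Config L) := {ω | ∀ e ∈ F, ω e = false}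

theorem measurableSet_allClosed (F : Set (Edge L)) : MeasurableSet[edgeSigma F] (allClosed F) := by
  have : allClosed F = ⋂ e ∈ F, {ω : Config L | ω e = false} := by
    ext ω
    simp [allClosed]
  rw [this]
  exact MeasurableSet.biInter (Set.to_countable _) fun e he => measurableSet_edge he _

theorem allClosed_eq_pi (F : Set (Edge L)) : allClosed F = Set.pi F fun _ => {false} := by
  ext ω
  simp [allClosed]

theorem bernoulli_false (J : Kernel L) (e : Edge L) :
    bernoulliMeasure true false (J.openProb e) {false} =
      ENNReal.ofReal (Real.exp (-(J e : ℝ))) := by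
  rw [bernoulliMeasure_apply_of_notMem_of_mem _ (measurableSet_singleton _) (by simp) (by simp)]
  rw [ENNReal.ofReal, ENNReal.coe_inj]
  ext
  rw [Real.coe_toNNReal _ (Real.exp_pos _).le]
  simp [Kernel.openProb, unitInterval.symm]

theorem ofReal_exp_neg_sum (J : Kernel L) {ι : Type*} (s : Finset ι) (f : ι → Edge L) :
    ∏ i ∈ s, bernoulliMeasure true false (J.openProb (f i)) {false} =
      ENNReal.ofReal (Real.exp (-∑ i ∈ s, (J (f i) : ℝ))) := by
  simp_rw [bernoulli_false]
  rw [← ENNReal.ofReal_prod_of_nonneg fun _ _ => (Real.exp_pos _).le, ← Real.exp_sum,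
    Finset.sum_neg_distrib]

theorem law_allClosed_finset (J : Kernel L) (F : Finset (Edge L)) :
    J.law.real (allClosed (F : Set (Edge L))) = Real.exp (-∑ e ∈ F, (J e : ℝ)) := by
  rw [measureReal_def, allClosed_eq_pi, Kernel.law, Measure.infinitePi_pi _ (by simp)]
  rw [ofReal_exp_neg_sum J F fun e => e, ENNReal.toReal_ofReal (Real.exp_pos _).le]

/-- The edges leaving a block are infinitely many. The infinite product of closing probabilities is
the infimum of the finite products, each of which is at least e^(-M). -/
theorem exp_neg_le_law_allClosed (J : Kernel L) (F : Set (Edge L)) {M : ℝ} (hM : 0 ≤ M)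
    (h : ∑' e : F, (J e : ℝ≥0∞) ≤ ENNReal.ofReal M) :
    Real.exp (-M) ≤ J.law.real (allClosed F) := by
  rw [measureReal_def, ← ENNReal.ofReal_le_iff_le_toReal (measure_ne_top _ _), allClosed_eq_pi,
    Kernel.law, Measure.infinitePi_pi_of_countable _ (Set.to_countable F) (by simp),
    ENNReal.tprod_eq_iInf_prod fun e => prob_le_one]
  refine le_iInf fun s => ?_
  rw [ofReal_exp_neg_sum J s (fun e => (e : Edge L))]
  refine ENNReal.ofReal_le_ofReal (Real.exp_le_exp.2 (neg_le_neg ?_))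
  rw [← ENNReal.ofReal_le_ofReal_iff hM]
  refine le_trans (le_of_eq ?_) ((ENNReal.sum_le_tsum s).trans h)
  rw [ENNReal.ofReal_sum_of_nonneg fun _ _ => NNReal.coe_nonneg _]
  simp

/-- Translation of edges. -/
def shiftEdge (z : Lattice L) (e : Edge L) : Edge L :=
  ⟨e.1.map (· + z), by
    obtain ⟨e, he⟩ := e
    induction e with
    | _ x y =>
      simpa using he⟩

theorem shiftEdge_injective (z : Lattice L) : Function.Injective (shiftEdge z) := by
  intro e f h
  exact Subtype.ext (Sym2.map.injective (add_left_injective z) (congrArg Subtype.val h))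

theorem shiftEdge_mkEdge (z x y : Lattice L) (h : x ≠ y) :
    shiftEdge z (mkEdge x y h) = mkEdge (x + z) (y + z) (by simpa using h) := by
  simp [shiftEdge, mkEdge]

theorem hdist_add_right (x y z : Lattice L) : hdist (x + z) (y + z) = hdist x y := by
  simp [hdist, level]

theorem edgeLength_shiftEdge (z : Lattice L) (e : Edge L) :
    edgeLength (shiftEdge z e) = edgeLength e := by
  obtain ⟨e, he⟩ := e
  induction e with
  | _ x y => simp [shiftEdge, edgeLength, hdist_add_right]

/-- Translation of configurations. -/
def shiftConfig (z : Lattice L) (ω : Config L) : Config L := fun e => ω (shiftEdge z e)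

/-- Translation is injective on edges and preserves lengths, hence opening probabilities. -/
theorem law_map_shiftConfig (J : Kernel L) (hiso : J.IsometryInvariant) (z : Lattice L) :
    J.law.map (shiftConfig z) = J.law := by
  have h := Measure.map_infinitePi_infinitePi_of_inj
    (P := fun e => bernoulliMeasure true false (J.openProb e)) (shiftEdge_injective z)
  have h2 : ∀ e, J.openProb (shiftEdge z e) = J.openProb e := by
    intro e
    apply Subtype.ext
    simp only [Kernel.openProb, hiso _ _ (edgeLength_shiftEdge z e)]
  simp only [h2] at h
  exact h

theorem measurable_shiftConfig (z : Lattice L) : Measurable (shiftConfig (L := L) z) :=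
  measurable_pi_lambda _ fun e => measurable_pi_apply (shiftEdge z e)

theorem law_real_preimage_shiftConfig (J : Kernel L) (hiso : J.IsometryInvariant) (z : Lattice L)
    {A : Set (Config L)} (hA : MeasurableSet A) :
    J.law.real (shiftConfig z ⁻¹' A) = J.law.real A := by
  conv_rhs => rw [← law_map_shiftConfig J hiso z]
  rw [measureReal_def, measureReal_def, Measure.map_apply (measurable_shiftConfig z) hA]

theorem openGraph_shiftConfig (z : Lattice L) (ω : Config L) (x y : Lattice L) :
    (openGraph (shiftConfig z ω)).Adj x y ↔ (openGraph ω).Adj (x + z) (y + z) := by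
  simp only [openGraph, shiftConfig, shiftEdge_mkEdge]
  constructor
  · rintro ⟨h, h'⟩
    exact ⟨by simpa using h, h'⟩
  · rintro ⟨h, h'⟩
    exact ⟨by simpa using h, h'⟩

/-- Translation is an isomorphism between the graphs of short open edges. -/
def shiftIso (n : ℕ) (z : Lattice L) (ω : Config L) :
    shortGraph n (shiftConfig z ω) ≃g shortGraph n ω where
  toEquiv := Equiv.addRight z
  map_rel_iff' := by
    intro x y
    change (openGraph ω).Adj (x + z) (y + z) ∧ Near n (x + z) (y + z) ↔
      (openGraph (shiftConfig z ω)).Adj x y ∧ Near n x y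
    rw [openGraph_shiftConfig, near_add_right]

theorem card_cl_shiftConfig [NeZero L] (n : ℕ) (z : Lattice L) (ω : Config L) (x : Lattice L) :
    (cl n (shiftConfig z ω) x).card = (cl n ω (x + z)).card := by
  refine Finset.card_equiv (Equiv.addRight z) fun y => ?_
  rw [mem_cl, mem_cl]
  exact ((shiftIso n z ω).reachable_iff (u := x) (v := y)).symm

/-- The edges of length at most `L ^ n` in the `n`-block of `x`. -/
def innerEdges (n : ℕ) (x : Lattice L) : Set (Edge L) :=
  {e | ∃ u v, ∃ h : u ≠ v, Near n x u ∧ Near n x v ∧ e = mkEdge u v h}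

theorem innerEdges_finite [NeZero L] (n : ℕ) (x : Lattice L) : (innerEdges n x).Finite := by
  have h := ((finite_near n x).prod (finite_near n x)).image
    (fun p : Lattice L × Lattice L => s(p.1, p.2))
  refine Set.Finite.of_finite_image (f := Subtype.val) (h.subset ?_)
    Subtype.val_injective.injOn
  rintro _ ⟨e, ⟨u, v, huv, hu, hv, rfl⟩, rfl⟩
  exact ⟨(u, v), ⟨hu, hv⟩, rfl⟩

theorem mkEdge_eq_iff {x y u v : Lattice L} (h : x ≠ y) (h' : u ≠ v) :
    mkEdge x y h = mkEdge u v h' ↔ (x = u ∧ y = v) ∨ (x = v ∧ y = u) := by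
  simp [mkEdge, Subtype.ext_iff]

theorem mkEdge_mem_innerEdges_iff {n : ℕ} {x u v : Lattice L} (h : u ≠ v) :
    mkEdge u v h ∈ innerEdges n x ↔ Near n x u ∧ Near n x v := by
  constructor
  · rintro ⟨u', v', h', hu, hv, he⟩
    rcases (mkEdge_eq_iff _ _).1 he with ⟨rfl, rfl⟩ | ⟨rfl, rfl⟩
    · exact ⟨hu, hv⟩
    · exact ⟨hv, hu⟩
  · rintro ⟨hu, hv⟩
    exact ⟨u, v, h, hu, hv, rfl⟩

theorem disjoint_innerEdges {n : ℕ} {x y : Lattice L} (h : ¬ Near n x y) :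
    Disjoint (innerEdges n x) (innerEdges n y) := by
  rw [Set.disjoint_left]
  rintro _ ⟨u, v, huv, hu, hv, rfl⟩ he
  exact h (hu.trans ((mkEdge_mem_innerEdges_iff huv).1 he).1.symm)

/-- The path stays in the n-block of x, so it only sees the inner edges of that block. -/
theorem reachable_congr {n : ℕ} {ω ω' : Config L} {x y : Lattice L}
    (h : ∀ e ∈ innerEdges n x, ω e = ω' e) (hr : (shortGraph n ω).Reachable x y) :
    (shortGraph n ω').Reachable x y := by
  have hr' := hr
  rw [SimpleGraph.reachable_iff_reflTransGen] at hr
  induction hr with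
  | refl => exact SimpleGraph.Reachable.refl _
  | @tail b c hb hbc ih =>
    rw [← SimpleGraph.reachable_iff_reflTransGen] at hb
    refine (ih hb).trans (SimpleGraph.Adj.reachable ⟨?_, hbc.2⟩)
    obtain ⟨⟨hne, hop⟩, hnear⟩ := hbc
    have hxb := near_of_reachable hb
    exact ⟨hne, (h _ ((mkEdge_mem_innerEdges_iff hne).2 ⟨hxb, hxb.trans hnear⟩)).symm.trans hop⟩

theorem cl_congr [NeZero L] {n : ℕ} {ω ω' : Config L} {x : Lattice L}
    (h : ∀ e ∈ innerEdges n x, ω e = ω' e) : cl n ω x = cl n ω' x := by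
  ext y
  rw [mem_cl, mem_cl]
  exact ⟨reachable_congr h, reachable_congr fun e he => (h e he).symm⟩

theorem measurableSet_cl [NeZero L] (n : ℕ) (x : Lattice L) (p : Finset (Lattice L) → Prop) :
    MeasurableSet[edgeSigma (innerEdges n x)] {ω | p (cl n ω x)} :=
  measurableSet_of_determined (innerEdges_finite n x) fun ω ω' h hω => by
    have := cl_congr h
    simp only [Set.mem_ofPred_eq] at hω ⊢
    rwa [← this]

theorem measurableSet_cl' [NeZero L] (n : ℕ) (x : Lattice L) (p : Finset (Lattice L) → Prop) :
    MeasurableSet {ω | p (cl n ω x)} :=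
  edgeSigma_le _ _ (measurableSet_cl n x p)

end Law

/-! ### Light clusters and the law of the cluster size -/

section Tail

variable {L : ℕ}

theorem ne_of_not_near {n : ℕ} {x y : Lattice L} (h : ¬ Near n x y) : x ≠ y := by
  rintro rfl
  exact h (Near.refl n x)

/-- The total weight of the edges joining a given vertex to the complement of its `n`-block. -/
def Kernel.tail (J : Kernel L) (n : ℕ) : ℝ≥0∞ :=
  ∑' y : {y : Lattice L // ¬ Near n 0 y}, (J.pair 0 y.1 : ℝ≥0∞)

theorem Kernel.pair_eq_of_hdist_eq {J : Kernel L} (hiso : J.IsometryInvariant)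
    {x y u v : Lattice L} (hxy : x ≠ y) (huv : u ≠ v) (h : hdist x y = hdist u v) :
    J (mkEdge x y hxy) = J (mkEdge u v huv) := hiso _ _ h

theorem Kernel.pair_of_ne (J : Kernel L) {x y : Lattice L} (h : x ≠ y) :
    J.pair x y = J (mkEdge x y h) := by
  simp [Kernel.pair, h]

theorem Kernel.tsum_pair_eq_tail {J : Kernel L} (hiso : J.IsometryInvariant) (n : ℕ)
    (x : Lattice L) :
    ∑' y : {y : Lattice L // ¬ Near n x y}, (J.pair x y.1 : ℝ≥0∞) = J.tail n := by
  have he : ∀ y, ¬ Near n 0 y ↔ ¬ Near n x (Equiv.addRight x y) := by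
    intro y
    rw [Equiv.coe_addRight, ← near_add_right (n := n) (x := 0) x, zero_add]
  rw [Kernel.tail, ← (Equiv.subtypeEquiv (Equiv.addRight x) he).tsum_eq]
  refine tsum_congr fun y => ?_
  have h0 : (0 : Lattice L) ≠ y.1 := ne_of_not_near y.2
  have h1 : x ≠ y.1 + x := by simpa using h0.symm
  change (J.pair x (y.1 + x) : ℝ≥0∞) = J.pair 0 y.1
  rw [J.pair_of_ne h0, J.pair_of_ne h1, Kernel.pair_eq_of_hdist_eq hiso h1 h0]
  simpa using hdist_add_right 0 y.1 x

/-- The edges joining a vertex of `K` to the complement of its `n`-block. -/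
def exitEdges (n : ℕ) (K : Finset (Lattice L)) : Set (Edge L) :=
  ⋃ u ∈ K, Set.range fun v : {v : Lattice L // ¬ Near n u v} =>
    mkEdge u v.1 (ne_of_not_near v.2)

theorem mkEdge_mem_exitEdges {n : ℕ} {K : Finset (Lattice L)} {u v : Lattice L} (hu : u ∈ K)
    (hv : ¬ Near n u v) (h : u ≠ v) : mkEdge u v h ∈ exitEdges n K :=
  Set.mem_iUnion₂.2 ⟨u, hu, ⟨v, hv⟩, rfl⟩

theorem tsum_exitEdges_le {J : Kernel L} (hiso : J.IsometryInvariant) (n : ℕ)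
    (K : Finset (Lattice L)) :
    ∑' e : exitEdges n K, (J e : ℝ≥0∞) ≤ K.card * J.tail n := by
  refine (ENNReal.tsum_biUnion_le (fun e : Edge L => (J e : ℝ≥0∞)) K _).trans ?_
  rw [← nsmul_eq_mul]
  refine Finset.sum_le_card_nsmul _ _ _ fun u _ => ?_
  have hinj : Function.Injective fun v : {v : Lattice L // ¬ Near n u v} =>
      mkEdge u v.1 (ne_of_not_near v.2) := by
    rintro ⟨v, hv⟩ ⟨w, hw⟩ h
    rcases (mkEdge_eq_iff _ _).1 h with ⟨_, h⟩ | ⟨_, h⟩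
    · exact Subtype.ext h
    · exact absurd (h ▸ Near.refl n u) hv
  rw [tsum_range (fun e : Edge L => (J e : ℝ≥0∞)) hinj, ← J.tsum_pair_eq_tail hiso n u]
  refine ENNReal.tsum_le_tsum fun v => ?_
  rw [J.pair_of_ne (ne_of_not_near v.2)]

theorem disjoint_innerEdges_exitEdges {n : ℕ} {x : Lattice L} {K : Finset (Lattice L)} :
    Disjoint (innerEdges n x) (exitEdges n K) := by
  rw [Set.disjoint_left]
  rintro _ ⟨u, v, huv, hu, hv, rfl⟩ he
  simp only [exitEdges, Set.mem_iUnion, Set.mem_range] at he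
  obtain ⟨a, _, ⟨b, hab⟩, he⟩ := he
  rcases (mkEdge_eq_iff _ _).1 he with ⟨rfl, rfl⟩ | ⟨rfl, rfl⟩
  · exact hab (hu.symm.trans hv)
  · exact hab (hv.symm.trans hu)

variable [NeZero L]

/-- An open path that leaves the cluster must first use an edge out of the n-block, starting from a
vertex of the cluster. -/
theorem cluster_eq_of_closed {n : ℕ} {ω : Config L} {x : Lattice L}
    (h : ω ∈ allClosed (exitEdges n (cl n ω x))) : cluster ω x = cl n ω x := by
  refine Set.Subset.antisymm (fun y hy => ?_) (coe_cl_subset_cluster n ω x)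
  have hy' : (openGraph ω).Reachable x y := hy
  rw [SimpleGraph.reachable_iff_reflTransGen] at hy'
  clear hy
  induction hy' with
  | refl => exact self_mem_cl n ω x
  | @tail b c _ hbc ih =>
    have hn : Near n b c := by
      by_contra hn
      obtain ⟨hne, hop⟩ := hbc
      have := h _ (mkEdge_mem_exitEdges ih hn hne)
      simp [this] at hop
    exact mem_cl.2 ((mem_cl.1 ih).trans (SimpleGraph.Adj.reachable ⟨hbc, hn⟩))

/-- The cluster of `x` is finite but has at least `k` vertices. -/
def largeFinite (k : ℕ) (x : Lattice L) : Set (Config L) :=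
  {ω | (∃ n, k ≤ (cl n ω x).card) ∧ (cluster ω x).Finite}

/-- Condition on the value K of the n-block cluster. This event depends on inner edges only, so it
is independent of the edges leaving the block from K; their total weight is at most |K| T_n ≤ M, so
all are closed with probability at least e^(-M). -/
theorem law_light_cluster_le {J : Kernel L} (hiso : J.IsometryInvariant) {n : ℕ}
    (hT : J.tail n ≠ ∞) (k : ℕ) (x : Lattice L) {M : ℝ} (hM : 0 ≤ M) :
    J.law.real {ω | k ≤ (cl n ω x).card ∧ (cl n ω x).card * (J.tail n).toReal ≤ M} *
      Real.exp (-M) ≤ J.law.real (largeFinite k x) := by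
  classical
  set P : Finset (Finset (Lattice L)) := (box n x).powerset.filter fun K =>
    k ≤ K.card ∧ K.card * (J.tail n).toReal ≤ M with hP
  have hcover : {ω | k ≤ (cl n ω x).card ∧ (cl n ω x).card * (J.tail n).toReal ≤ M} ⊆
      ⋃ K ∈ P, {ω | cl n ω x = K} := by
    intro ω hω
    simp only [Set.mem_iUnion]
    exact ⟨cl n ω x, Finset.mem_filter.2 ⟨Finset.mem_powerset.2 (cl_subset_box n ω x), hω⟩, rfl⟩
  have hK : ∀ K ∈ P, J.law.real {ω | cl n ω x = K} * Real.exp (-M) ≤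
      J.law.real ({ω | cl n ω x = K} ∩ allClosed (exitEdges n K)) := by
    intro K hK
    rw [law_real_inter J (disjoint_innerEdges_exitEdges (n := n) (x := x) (K := K))
      (measurableSet_cl n x (· = K)) (measurableSet_allClosed _)]
    refine mul_le_mul_of_nonneg_left ?_ measureReal_nonneg
    refine exp_neg_le_law_allClosed J _ hM ((tsum_exitEdges_le hiso n K).trans ?_)
    rw [ENNReal.le_ofReal_iff_toReal_le (ENNReal.mul_ne_top (ENNReal.natCast_ne_top _) hT) hM,
      ENNReal.toReal_mul, ENNReal.toReal_natCast]
    exact (Finset.mem_filter.1 hK).2.2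
  calc _ ≤ (∑ K ∈ P, J.law.real {ω | cl n ω x = K}) * Real.exp (-M) := by
        refine mul_le_mul_of_nonneg_right ?_ (Real.exp_pos _).le
        exact (measureReal_mono hcover (measure_ne_top _ _)).trans
          (measureReal_biUnion_finset_le _ _)
    _ ≤ ∑ K ∈ P, J.law.real ({ω | cl n ω x = K} ∩ allClosed (exitEdges n K)) := by
        rw [Finset.sum_mul]
        exact Finset.sum_le_sum hK
    _ = J.law.real (⋃ K ∈ P, ({ω | cl n ω x = K} ∩ allClosed (exitEdges n K))) := by
        rw [measureReal_biUnion_finset]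
        · intro K _ K' _ hne
          rw [Function.onFun, Set.disjoint_left]
          rintro ω ⟨h, _⟩ ⟨h', _⟩
          exact hne (h.symm.trans h')
        · exact fun K _ => (measurableSet_cl' n x (· = K)).inter
            (edgeSigma_le _ _ (measurableSet_allClosed _))
    _ ≤ J.law.real (largeFinite k x) := by
        refine measureReal_mono ?_
        simp only [Set.iUnion_subset_iff]
        rintro K hK ω ⟨rfl, hω⟩
        refine ⟨⟨n, (Finset.mem_filter.1 hK).2.1⟩, ?_⟩
        rw [cluster_eq_of_closed hω]
        exact Finset.finite_toSet _

/-- The cluster of `x` has at least `k` vertices. -/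
def largeCluster (k : ℕ) (x : Lattice L) : Set (Config L) := {ω | ∃ n, k ≤ (cl n ω x).card}

theorem largeCluster_eq_iUnion (k : ℕ) (x : Lattice L) :
    largeCluster k x = ⋃ n, {ω | k ≤ (cl n ω x).card} := by
  ext ω
  simp [largeCluster]

theorem measurableSet_largeCluster (k : ℕ) (x : Lattice L) :
    MeasurableSet (largeCluster k x) := by
  rw [largeCluster_eq_iUnion]
  exact MeasurableSet.iUnion fun n => measurableSet_cl' n x fun K => k ≤ K.card

theorem infinite_cluster_eq_iInter (x : Lattice L) :
    {ω : Config L | (cluster ω x).Infinite} = ⋂ k, largeCluster k x := by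
  ext ω
  simp only [Set.mem_ofPred_eq, Set.mem_iInter, largeCluster]
  constructor
  · intro h k
    obtain ⟨s, hs, hk⟩ := h.exists_subset_card_eq k
    have hN : ∀ y ∈ s, ∃ n, y ∈ cl n ω x := by
      intro y hy
      have := hs hy
      rw [cluster_eq_iUnion] at this
      simpa using this
    choose! N hN using hN
    refine ⟨s.sup N, hk ▸ Finset.card_le_card fun y hy => ?_⟩
    exact cl_mono (Finset.le_sup hy) ω x (hN y hy)
  · intro h hfin
    obtain ⟨n, hn⟩ := h (hfin.toFinset.card + 1)
    have : cl n ω x ⊆ hfin.toFinset := fun y hy =>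
      hfin.mem_toFinset.2 (coe_cl_subset_cluster n ω x hy)
    have := Finset.card_le_card this
    omega

theorem tendsto_law_largeCluster (J : Kernel L) :
    Tendsto (fun k => J.law.real (largeCluster k (0 : Lattice L))) atTop (𝓝 J.theta) := by
  rw [Kernel.theta, infinite_cluster_eq_iInter]
  refine (ENNReal.tendsto_toReal (measure_ne_top _ _)).comp (tendsto_measure_iInter_atTop
    (fun k => (measurableSet_largeCluster k 0).nullMeasurableSet) ?_ ⟨0, measure_ne_top _ _⟩)
  rintro k l hkl ω ⟨n, hn⟩
  exact ⟨n, hkl.trans hn⟩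

theorem tendsto_law_le_card_cl (J : Kernel L) (k : ℕ) (x : Lattice L) :
    Tendsto (fun m => J.law.real {ω | k ≤ (cl m ω x).card}) atTop
      (𝓝 (J.law.real (largeCluster k x))) := by
  rw [largeCluster_eq_iUnion]
  refine (ENNReal.tendsto_toReal (measure_ne_top _ _)).comp (tendsto_measure_iUnion_atTop ?_)
  intro m n hmn ω hω
  exact le_trans hω (Finset.card_le_card (cl_mono hmn ω x))

theorem theta_le_law_largeCluster (J : Kernel L) (k : ℕ) :
    J.theta ≤ J.law.real (largeCluster k (0 : Lattice L)) := by
  rw [Kernel.theta, infinite_cluster_eq_iInter]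
  exact measureReal_mono (Set.iInter_subset _ k)

theorem law_largeFinite (J : Kernel L) (k : ℕ) :
    J.law.real (largeFinite k (0 : Lattice L)) =
      J.law.real (largeCluster k (0 : Lattice L)) - J.theta := by
  have hsub : {ω : Config L | (cluster ω 0).Infinite} ⊆ largeCluster k 0 := by
    rw [infinite_cluster_eq_iInter]
    exact Set.iInter_subset _ k
  have hm : MeasurableSet {ω : Config L | (cluster ω 0).Infinite} := by
    rw [infinite_cluster_eq_iInter]
    exact MeasurableSet.iInter fun k => measurableSet_largeCluster k 0
  rw [Kernel.theta, ← measureReal_sdiff hsub hm]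
  congr 1
  ext ω
  simp [largeFinite, largeCluster]

/-- The events |K_0| ≥ k decrease to |K_0| = ∞, so their probabilities tend to θ. -/
theorem exists_law_largeFinite_le (J : Kernel L) {η : ℝ} (hη : 0 < η) :
    ∃ k, J.law.real (largeFinite k (0 : Lattice L)) ≤ η := by
  have h := (tendsto_law_largeCluster J).eventually (gt_mem_nhds (lt_add_of_pos_right J.theta hη))
  obtain ⟨k, hk⟩ := h.exists
  exact ⟨k, by rw [law_largeFinite]; linarith⟩

/-- The joint law at two scales is needed because heaviness is tested at scale n and size at least k
at a fixed scale m. -/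
theorem law_card_cl_eq {J : Kernel L} (hiso : J.IsometryInvariant) (m n : ℕ) (x : Lattice L)
    (p : ℕ → ℕ → Prop) :
    J.law.real {ω | p (cl m ω x).card (cl n ω x).card} =
      J.law.real {ω | p (cl m ω 0).card (cl n ω 0).card} := by
  have hm : MeasurableSet {ω : Config L | p (cl m ω 0).card (cl n ω 0).card} := by
    have h : {ω : Config L | p (cl m ω 0).card (cl n ω 0).card} =
        ⋃ K : Finset (Lattice L), ⋃ K' : Finset (Lattice L), ⋃ _ : p K.card K'.card,
          {ω | cl m ω 0 = K} ∩ {ω | cl n ω 0 = K'} := by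
      ext ω
      simp
    rw [h]
    exact MeasurableSet.iUnion fun K => MeasurableSet.iUnion fun K' => MeasurableSet.iUnion fun _ =>
      (measurableSet_cl' m 0 (· = K)).inter (measurableSet_cl' n 0 (· = K'))
  rw [← law_real_preimage_shiftConfig J hiso x hm]
  congr 1
  ext ω
  simp [card_cl_shiftConfig]

end Tail

/-! ### Abundance of heavy vertices -/

section Abundance

section Counting

variable {Ω ι : Type*}

open Classical in
theorem card_filter_eq_sum_indicator (s : Finset ι) (A : ι → Set Ω) (ω : Ω) :
    ((s.filter fun i => ω ∈ A i).card : ℝ) = ∑ i ∈ s, (A i).indicator (fun _ => (1 : ℝ)) ω := by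
  simp [Set.indicator_apply]

variable [MeasurableSpace Ω] {μ : Measure Ω} [IsProbabilityMeasure μ]

theorem integrable_indicator_one {A : Set Ω} (hA : MeasurableSet A) :
    Integrable (A.indicator fun _ => (1 : ℝ)) μ :=
  (integrable_const 1).indicator hA

open Classical in
/-- Markov's inequality for the number of events that occur. -/
theorem mul_measureReal_le_card_filter (s : Finset ι) {A : ι → Set Ω}
    (hA : ∀ i, MeasurableSet (A i)) (c : ℝ) :
    c * μ.real {ω | c ≤ (s.filter fun i => ω ∈ A i).card} ≤ ∑ i ∈ s, μ.real (A i) := by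
  simp_rw [card_filter_eq_sum_indicator]
  refine (mul_meas_ge_le_integral_of_nonneg (ae_of_all _ fun ω => ?_)
    (integrable_finsetSum _ fun i _ => integrable_indicator_one (hA i)) c).trans_eq ?_
  · exact Finset.sum_nonneg fun i _ => Set.indicator_nonneg (fun _ _ => zero_le_one) _
  · rw [integral_finsetSum _ fun i _ => integrable_indicator_one (hA i)]
    refine Finset.sum_congr rfl fun i _ => ?_
    rw [integral_indicator_const _ (hA i)]
    simp

open Classical in
/-- Chebyshev's inequality for the number of events that occur, when events `A i` and `A j` that
are not related by `r` are independent. -/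
theorem measureReal_card_filter_le (s : Finset ι) {A : ι → Set Ω}
    (hA : ∀ i, MeasurableSet (A i)) (r : ι → ι → Prop)
    (hind : ∀ i ∈ s, ∀ j ∈ s, ¬ r i j → μ.real (A i ∩ A j) = μ.real (A i) * μ.real (A j))
    {c : ℝ} (hc : 0 < c) :
    μ.real {ω | ((s.filter fun i => ω ∈ A i).card : ℝ) ≤ ∑ i ∈ s, μ.real (A i) - c} ≤
      (∑ i ∈ s, ((s.filter fun j => r i j).card : ℝ)) / c ^ 2 := by
  have hmem : ∀ i ∈ s, MemLp ((A i).indicator fun _ => (1 : ℝ)) 2 μ := fun i _ =>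
    (memLp_const 1).indicator (hA i)
  have hint : ∀ i, ∫ ω, (A i).indicator (fun _ => (1 : ℝ)) ω ∂μ = μ.real (A i) := by
    intro i
    rw [integral_indicator_const _ (hA i)]
    simp
  have hcov : ∀ i ∈ s, ∀ j ∈ s, cov[(A i).indicator fun _ => (1 : ℝ),
      (A j).indicator fun _ => (1 : ℝ); μ] ≤ if r i j then 1 else 0 := by
    intro i hi j hj
    rw [covariance_eq_sub (hmem i hi) (hmem j hj), hint, hint]
    have : (A i).indicator (fun _ => (1 : ℝ)) * (A j).indicator (fun _ => (1 : ℝ)) =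
        (A i ∩ A j).indicator fun _ => (1 : ℝ) := by
      ext ω
      by_cases h1 : ω ∈ A i <;> by_cases h2 : ω ∈ A j <;> simp [h1, h2]
    rw [this, integral_indicator_const _ ((hA i).inter (hA j))]
    split_ifs with h
    · have h1 : μ.real (A i ∩ A j) ≤ 1 := measureReal_le_one
      have h2 : 0 ≤ μ.real (A i) * μ.real (A j) := by positivity
      simp only [smul_eq_mul, mul_one]
      linarith
    · rw [hind i hi j hj h]
      simp
  have hvar : Var[fun ω => ∑ i ∈ s, (A i).indicator (fun _ => (1 : ℝ)) ω; μ] ≤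
      ∑ i ∈ s, ((s.filter fun j => r i j).card : ℝ) := by
    rw [variance_fun_sum' hmem]
    refine Finset.sum_le_sum fun i hi => ?_
    refine (Finset.sum_le_sum fun j hj => hcov i hi j hj).trans_eq ?_
    simp
  have hcheb := meas_ge_le_variance_div_sq (memLp_finsetSum s hmem) hc
  rw [integral_finsetSum _ fun i _ => integrable_indicator_one (hA i)] at hcheb
  simp_rw [hint] at hcheb
  have hreal : μ.real {ω | c ≤ |∑ i ∈ s, (A i).indicator (fun _ => (1 : ℝ)) ω -
      ∑ i ∈ s, μ.real (A i)|} ≤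
      Var[fun ω => ∑ i ∈ s, (A i).indicator (fun _ => (1 : ℝ)) ω; μ] / c ^ 2 := by
    rw [measureReal_def]
    exact ENNReal.toReal_le_of_le_ofReal (div_nonneg (variance_nonneg _ _) (sq_nonneg c)) hcheb
  refine le_trans (measureReal_mono ?_ (measure_ne_top _ _)) (hreal.trans (by gcongr))
  intro ω hω
  simp only [Set.mem_ofPred_eq, card_filter_eq_sum_indicator] at hω ⊢
  rw [abs_sub_comm]
  exact le_trans (by linarith) (le_abs_self _)

end Counting

variable {L : ℕ} [NeZero L]

open Classical in
-- Chebyshev: each vertex is correlated with at most the L^m vertices of its m-block, so the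
-- variance is at most L^n L^m, against the squared deviation (a L^n)^2.
theorem law_card_large_le {J : Kernel L} (hiso : J.IsometryInvariant) (k : ℕ) {m n : ℕ}
    (z : Lattice L) {a : ℝ} (ha : 0 < a) :
    J.law.real {ω | (((box n z).filter fun x => k ≤ (cl m ω x).card).card : ℝ) ≤
      (J.law.real {ω | k ≤ (cl m ω 0).card} - a) * L ^ n} ≤ L ^ m / (a ^ 2 * L ^ n) := by
  have hL : (0 : ℝ) < L := Nat.cast_pos.2 (NeZero.pos L)
  have h := measureReal_card_filter_le (μ := J.law) (box n z)
    (A := fun x => {ω | k ≤ (cl m ω x).card}) (fun x => measurableSet_cl' m x fun K => k ≤ K.card)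
    (Near m) (fun x _ y _ hxy => law_real_inter J (disjoint_innerEdges hxy)
      (measurableSet_cl m x fun K => k ≤ K.card) (measurableSet_cl m y fun K => k ≤ K.card))
    (c := a * L ^ n) (by positivity)
  have hp : ∀ x : Lattice L, J.law.real {ω | k ≤ (cl m ω x).card} =
      J.law.real {ω | k ≤ (cl m ω 0).card} := fun x =>
    law_card_cl_eq hiso m m x fun a _ => k ≤ a
  simp only [hp, Finset.sum_const, card_box, nsmul_eq_mul, Nat.cast_pow] at h
  have hsum : ∑ x ∈ box n z, (((box n z).filter fun y => Near m x y).card : ℝ) ≤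
      (L : ℝ) ^ n * L ^ m := by
    calc _ ≤ ∑ x ∈ box n z, (L : ℝ) ^ m := by
          refine Finset.sum_le_sum fun x _ => ?_
          rw [← Nat.cast_pow, Nat.cast_le, ← card_box m x]
          exact Finset.card_le_card fun y hy => mem_box.2 (Finset.mem_filter.1 hy).2
      _ = _ := by simp [card_box]
  refine le_trans (le_of_eq ?_) (h.trans ((div_le_div_of_nonneg_right hsum (by positivity)).trans
    (le_of_eq ?_)))
  · congr 1
    ext ω
    simp only [Set.mem_ofPred_eq]
    rw [sub_mul, mul_comm ((L : ℝ) ^ n)]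
  · field_simp

open Classical in
/-- With high probability, nearly a fraction `θ` of the vertices of an `n`-block are in clusters
of that block that send out at least `M` edges on average. -/
theorem eventually_law_card_heavy_lt_le (hL : 2 ≤ L) {J : Kernel L} (hiso : J.IsometryInvariant)
    (hT : ∀ᶠ n in atTop, J.tail n ≠ ∞) {M ε δ : ℝ} (hM : 0 ≤ M) (hε : 0 < ε) (hδ : 0 < δ) :
    ∀ᶠ n in atTop, ∀ z : Lattice L,
      J.law.real {ω | (((box n z).filter fun x =>
        M < (cl n ω x).card * (J.tail n).toReal).card : ℝ) < (J.theta - ε) * L ^ n} ≤ δ := by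
  have hLpos : (0 : ℝ) < L := Nat.cast_pos.2 (NeZero.pos L)
  -- The factor e^(-M) absorbs the loss in `law_light_cluster_le`. What remains, ε δ / 4, is the
  -- bound δ / 2 after Markov's inequality at level ε / 2.
  obtain ⟨k, hk⟩ := exists_law_largeFinite_le J
    (η := Real.exp (-M) * (ε * δ / 4)) (mul_pos (Real.exp_pos _) (by positivity))
  have hm := (tendsto_law_le_card_cl J k 0).eventually (lt_mem_nhds
    (show J.theta - ε / 4 < _ by linarith [theta_le_law_largeCluster J k]))
  obtain ⟨m, hm⟩ := hm.exists
  have hlim : Tendsto (fun n : ℕ => (L : ℝ) ^ m / ((ε / 4) ^ 2 * L ^ n)) atTop (𝓝 0) := by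
    refine tendsto_const_nhds.div_atTop (Tendsto.const_mul_atTop (by positivity) ?_)
    exact tendsto_pow_atTop_atTop_of_one_lt (by exact_mod_cast hL)
  filter_upwards [hT, eventually_ge_atTop m,
    hlim.eventually (gt_mem_nhds (show (0 : ℝ) < δ / 2 by positivity))] with n hTn hmn hn z
  have hLn : (0 : ℝ) < (L : ℝ) ^ n := by positivity
  have h1 := (law_card_large_le hiso k (m := m) (n := n) z
    (show (0 : ℝ) < ε / 4 by positivity)).trans hn.le
  -- Bad vertices: large already at scale m, yet light at scale n. A vertex large at scale m is
  -- heavy or bad; the losses are ε / 4 for the choice of m, ε / 4 for Chebyshev and ε / 2 for bad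
  -- vertices.
  obtain ⟨B, hB⟩ : ∃ B : Lattice L → Set (Config L), ∀ x, B x =
    {ω | k ≤ (cl m ω x).card ∧ (cl n ω x).card * (J.tail n).toReal ≤ M} := ⟨_, fun _ => rfl⟩
  have hBmeas : ∀ x, MeasurableSet (B x) := fun x => by
    rw [hB]
    exact (measurableSet_cl' m x fun K => k ≤ K.card).inter
      (measurableSet_cl' n x fun K => K.card * (J.tail n).toReal ≤ M)
  have hBlaw : ∀ x, J.law.real (B x) ≤ ε * δ / 4 := by
    intro x
    have e1 : J.law.real (B x) = J.law.real (B 0) := by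
      rw [hB, hB]
      exact law_card_cl_eq hiso m n x fun a b => k ≤ a ∧ b * (J.tail n).toReal ≤ M
    have e2 : J.law.real (B 0) ≤ J.law.real
        {ω | k ≤ (cl n ω 0).card ∧ (cl n ω 0).card * (J.tail n).toReal ≤ M} := by
      rw [hB]
      exact measureReal_mono (fun ω hω =>
        ⟨hω.1.trans (Finset.card_le_card (cl_mono hmn ω 0)), hω.2⟩) (measure_ne_top _ _)
    have e3 := (law_light_cluster_le hiso hTn k 0 hM).trans hk
    rw [mul_comm] at e3
    rw [e1]
    exact e2.trans (le_of_mul_le_mul_left e3 (Real.exp_pos _))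
  have h2 := mul_measureReal_le_card_filter (μ := J.law) (box n z) hBmeas (ε / 2 * L ^ n)
  have h3 : ∑ x ∈ box n z, J.law.real (B x) ≤ L ^ n * (ε * δ / 4) := by
    refine (Finset.sum_le_sum fun x _ => hBlaw x).trans_eq ?_
    simp [card_box]
  have h4 : J.law.real {ω | ε / 2 * (L : ℝ) ^ n ≤ ((box n z).filter fun x => ω ∈ B x).card} ≤
      δ / 2 := by
    have hpos : 0 < ε / 2 * (L : ℝ) ^ n := by positivity
    refine le_of_mul_le_mul_left ((h2.trans h3).trans_eq ?_) hpos
    ring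
  have hsub : {ω | (((box n z).filter fun x =>
        M < (cl n ω x).card * (J.tail n).toReal).card : ℝ) < (J.theta - ε) * L ^ n} ⊆
      {ω | (((box n z).filter fun x => k ≤ (cl m ω x).card).card : ℝ) ≤
        (J.law.real {ω | k ≤ (cl m ω 0).card} - ε / 4) * L ^ n} ∪
      {ω | ε / 2 * (L : ℝ) ^ n ≤ ((box n z).filter fun x => ω ∈ B x).card} := by
    intro ω hω
    by_contra hcon
    simp only [Set.mem_union, Set.mem_ofPred_eq, not_or, not_le] at hcon hω
    obtain ⟨c1, c2⟩ := hcon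
    have hcard : ((box n z).filter fun x => k ≤ (cl m ω x).card).card ≤
        ((box n z).filter fun x => M < (cl n ω x).card * (J.tail n).toReal).card +
        ((box n z).filter fun x => ω ∈ B x).card := by
      refine le_trans (Finset.card_le_card fun x hx => ?_) (Finset.card_union_le _ _)
      rw [Finset.mem_filter] at hx
      rw [Finset.mem_union, Finset.mem_filter, Finset.mem_filter]
      by_cases h : M < (cl n ω x).card * (J.tail n).toReal
      · exact Or.inl ⟨hx.1, h⟩
      · exact Or.inr ⟨hx.1, hB x ▸ ⟨hx.2, not_lt.1 h⟩⟩
    have hcard' : (((box n z).filter fun x => k ≤ (cl m ω x).card).card : ℝ) ≤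
        ((box n z).filter fun x => M < (cl n ω x).card * (J.tail n).toReal).card +
        ((box n z).filter fun x => ω ∈ B x).card := by exact_mod_cast hcard
    nlinarith
  calc _ ≤ _ := measureReal_mono hsub (measure_ne_top _ _)
    _ ≤ _ := measureReal_union_le _ _
    _ ≤ δ / 2 + δ / 2 := add_le_add h1 h4
    _ = δ := by ring

theorem eventually_le_pow_mul_tail (hL : 2 ≤ L) {J : Kernel L} (hiso : J.IsometryInvariant)
    (hT : ∀ᶠ n in atTop, J.tail n ≠ ∞) (hθ : 0 < J.theta) (M : ℝ) :
    ∀ᶠ n in atTop, M ≤ L ^ n * (J.tail n).toReal := by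
  classical
  filter_upwards [eventually_law_card_heavy_lt_le hL hiso hT (le_max_right M 0) (half_pos hθ)
    (half_pos one_pos)] with n hn
  have hLpos : (0 : ℝ) < (L : ℝ) ^ n := pow_pos (Nat.cast_pos.2 (NeZero.pos L)) n
  by_contra hcon
  rw [not_le] at hcon
  -- If L^n T_n < M, no cluster of an n-block is heavy, so the event of probability at most 1 / 2
  -- would be certain.
  have huniv : {ω : Config L | (((box n (0 : Lattice L)).filter fun x =>
      max M 0 < (cl n ω x).card * (J.tail n).toReal).card : ℝ) <
        (J.theta - J.theta / 2) * L ^ n} = Set.univ := by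
    refine Set.eq_univ_of_forall fun ω => ?_
    have hempty : ((box n (0 : Lattice L)).filter fun x =>
        max M 0 < (cl n ω x).card * (J.tail n).toReal) = ∅ := by
      refine Finset.filter_eq_empty_iff.2 fun x _ => not_lt.2 (le_trans ?_ (le_max_left M 0))
      refine le_trans (mul_le_mul_of_nonneg_right ?_ ENNReal.toReal_nonneg) hcon.le
      rw [← Nat.cast_pow, Nat.cast_le, ← card_box n x]
      exact Finset.card_le_card (cl_subset_box n ω x)
    simp only [Set.mem_ofPred_eq, hempty, Finset.card_empty, Nat.cast_zero]
    nlinarith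
  have := hn 0
  rw [huniv, probReal_univ] at this
  linarith

end Abundance

/-! ### Union bound over closed cuts between heavy clusters -/

section Cut

variable {L : ℕ}

/-- The common weight of the edges of length `L ^ (n + 1)`. -/
def Kernel.weight (J : Kernel L) (n : ℕ) : ℝ≥0 := J.pair 0 (Finsupp.single n 1)

theorem hdist_eq_of_near {n : ℕ} {x y : Lattice L} (h : ¬ Near n x y) (h' : Near (n + 1) x y) :
    hdist x y = (L : ℝ) ^ (n + 1) := by
  have h1 : level x y ≤ n + 1 := level_le_iff.2 h'
  have h2 : ¬ level x y ≤ n := fun hl => h (level_le_iff.1 hl)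
  have h3 : level x y = n + 1 := by omega
  simp [hdist, ne_of_not_near h, h3]

theorem near_single (n : ℕ) (c : ZMod L) : Near (n + 1) 0 (Finsupp.single n c) := by
  intro i hi
  rw [Finsupp.single_eq_of_ne (by omega)]
  rfl

theorem Kernel.eq_weight (hL : 2 ≤ L) {J : Kernel L} (hiso : J.IsometryInvariant) {n : ℕ}
    {x y : Lattice L} (h : ¬ Near n x y) (h' : Near (n + 1) x y) (hne : x ≠ y) :
    J (mkEdge x y hne) = J.weight n := by
  have : Fact (1 < L) := ⟨hL⟩
  have h0 : ¬ Near n 0 (Finsupp.single n (1 : ZMod L)) := by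
    intro h
    simpa using h n le_rfl
  rw [Kernel.weight, J.pair_of_ne (ne_of_not_near h0)]
  exact hiso _ _ ((hdist_eq_of_near h h').trans (hdist_eq_of_near h0 (near_single n 1)).symm)

open Classical in
/-- The pairs in `S × T` that are in different `n`-blocks. -/
def crossPairs (n : ℕ) (S T : Finset (Lattice L)) : Finset (Lattice L × Lattice L) :=
  (S ×ˢ T).filter fun p => ¬ Near n p.1 p.2

theorem mem_crossPairs {n : ℕ} {S T : Finset (Lattice L)} {p : Lattice L × Lattice L} :
    p ∈ crossPairs n S T ↔ (p.1 ∈ S ∧ p.2 ∈ T) ∧ ¬ Near n p.1 p.2 := by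
  classical
  simp [crossPairs]

/-- The edge joining a pair of vertices in different `n`-blocks. -/
def crossEdge (n : ℕ) (S T : Finset (Lattice L)) (p : crossPairs n S T) : Edge L :=
  mkEdge p.1.1 p.1.2 (ne_of_not_near (mem_crossPairs.1 p.2).2)

theorem crossEdge_injective {n : ℕ} {S T : Finset (Lattice L)} (h : Disjoint S T) :
    Function.Injective (crossEdge n S T) := by
  rintro ⟨⟨u, v⟩, hp⟩ ⟨⟨u', v'⟩, hp'⟩ he
  have hu := (mem_crossPairs.1 hp).1.1
  have hv' := (mem_crossPairs.1 hp').1.2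
  rcases (mkEdge_eq_iff _ _).1 he with ⟨h1, h2⟩ | ⟨h1, h2⟩
  · exact Subtype.ext (Prod.ext h1 h2)
  · exact absurd (show u ∈ T from (show u = v' from h1) ▸ hv') (Finset.disjoint_left.1 h hu)

/-- This makes the edges across a cut independent of the n-block clusters that define it. -/
theorem disjoint_innerEdges_crossEdge (n : ℕ) (S T V : Finset (Lattice L)) :
    Disjoint (⋃ x ∈ V, innerEdges n x) (Set.range (crossEdge n S T)) := by
  rw [Set.disjoint_left]
  rintro e he ⟨⟨⟨u, v⟩, hp⟩, rfl⟩
  simp only [Set.mem_iUnion] at he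
  obtain ⟨x, _, he⟩ := he
  obtain ⟨hu, hv⟩ := (mkEdge_mem_innerEdges_iff _).1 he
  exact (mem_crossPairs.1 hp).2 (hu.symm.trans hv)

theorem disjoint_biUnion_sdiff {α : Type*} [DecidableEq α] {𝒦 𝒮 : Finset (Finset α)}
    (h : (𝒦 : Set (Finset α)).PairwiseDisjoint id) (h𝒮 : 𝒮 ⊆ 𝒦) :
    Disjoint (𝒮.biUnion id) ((𝒦 \ 𝒮).biUnion id) := by
  simp only [Finset.disjoint_biUnion_left, Finset.disjoint_biUnion_right]
  intro K hK K' hK'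
  rw [Finset.mem_sdiff] at hK
  exact h (h𝒮 hK') hK.1 fun he => hK.2 (he ▸ hK')

variable [NeZero L]

theorem law_allClosed_crossEdge (hL : 2 ≤ L) {J : Kernel L} (hiso : J.IsometryInvariant) {n : ℕ}
    {S T : Finset (Lattice L)} {z : Lattice L} (hS : S ⊆ box (n + 1) z) (hT : T ⊆ box (n + 1) z)
    (h : Disjoint S T) :
    J.law.real (allClosed (Set.range (crossEdge n S T))) =
      Real.exp (-(J.weight n * (crossPairs n S T).card)) := by
  have hF : (Finset.univ.map ⟨crossEdge n S T, crossEdge_injective h⟩ : Set (Edge L)) =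
      Set.range (crossEdge n S T) := by simp
  rw [← hF, law_allClosed_finset, Finset.sum_map]
  congr 2
  have hw : ∀ p : crossPairs n S T, J (crossEdge n S T p) = J.weight n := by
    rintro ⟨⟨u, v⟩, hp⟩
    obtain ⟨⟨hu, hv⟩, hn⟩ := mem_crossPairs.1 hp
    exact J.eq_weight hL hiso hn ((mem_box.1 (hS hu)).symm.trans (mem_box.1 (hT hv))) _
  simp only [Function.Embedding.coeFn_mk, hw]
  simp [mul_comm]

open Classical in
/-- The vertices of the `(n + 1)`-block of the origin whose cluster in their `n`-block satisfies
`p`. -/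
def selected (n : ℕ) (p : Finset (Lattice L) → Prop) (ω : Config L) : Finset (Lattice L) :=
  (box (n + 1) 0).filter fun x => p (cl n ω x)

theorem mem_selected {n : ℕ} {p : Finset (Lattice L) → Prop} {ω : Config L} {x : Lattice L} :
    x ∈ selected n p ω ↔ Near (n + 1) 0 x ∧ p (cl n ω x) := by
  classical
  simp [selected]

open Classical in
/-- The clusters of the vertices in `selected n p ω`. -/
def selectedClusters (n : ℕ) (p : Finset (Lattice L) → Prop) (ω : Config L) :
    Finset (Finset (Lattice L)) := (selected n p ω).image (cl n ω)

theorem mem_selectedClusters {n : ℕ} {p : Finset (Lattice L) → Prop} {ω : Config L}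
    {K : Finset (Lattice L)} :
    K ∈ selectedClusters n p ω ↔ ∃ x ∈ selected n p ω, cl n ω x = K := by
  classical
  simp [selectedClusters]

theorem pairwiseDisjoint_selectedClusters (n : ℕ) (p : Finset (Lattice L) → Prop) (ω : Config L) :
    (selectedClusters n p ω : Set (Finset (Lattice L))).PairwiseDisjoint id := by
  intro K hK K' hK' hne
  obtain ⟨x, _, rfl⟩ := mem_selectedClusters.1 hK
  obtain ⟨y, _, rfl⟩ := mem_selectedClusters.1 hK'
  refine Finset.disjoint_left.2 fun z hx hy => hne ?_
  exact cl_eq_of_reachable ((mem_cl.1 hx).trans (mem_cl.1 hy).symm)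

theorem subset_box_of_mem_selectedClusters {n : ℕ} {p : Finset (Lattice L) → Prop} {ω : Config L}
    {K : Finset (Lattice L)} (hK : K ∈ selectedClusters n p ω) : K ⊆ box (n + 1) 0 := by
  obtain ⟨x, hx, rfl⟩ := mem_selectedClusters.1 hK
  intro y hy
  exact mem_box.2 ((mem_selected.1 hx).1.trans
    ((near_of_reachable (mem_cl.1 hy)).mono n.le_succ))

/-- The clusters are disjoint subsets of a block of L^(n+1) vertices, and each has |K| T > M. -/
theorem card_selectedClusters_mul_le {n : ℕ} {M T : ℝ} (hT : 0 ≤ T) (ω : Config L) :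
    (selectedClusters n (fun K => M < K.card * T) ω).card * M ≤ L ^ (n + 1) * T := by
  classical
  set 𝒦 := selectedClusters n (fun K => M < K.card * T) ω with h𝒦
  have h1 : (𝒦.biUnion id).card ≤ L ^ (n + 1) := by
    rw [← card_box (n + 1) (0 : Lattice L)]
    exact Finset.card_le_card (Finset.biUnion_subset.2 fun K hK =>
      subset_box_of_mem_selectedClusters hK)
  rw [Finset.card_biUnion (pairwiseDisjoint_selectedClusters n _ ω)] at h1
  calc (𝒦.card : ℝ) * M = ∑ K ∈ 𝒦, M := by simp
    _ ≤ ∑ K ∈ 𝒦, (K.card : ℝ) * T := by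
        refine Finset.sum_le_sum fun K hK => ?_
        obtain ⟨x, hx, rfl⟩ := mem_selectedClusters.1 hK
        exact (mem_selected.1 hx).2.le
    _ = ((∑ K ∈ 𝒦, K.card : ℕ) : ℝ) * T := by rw [← Finset.sum_mul]; push_cast; rfl
    _ ≤ L ^ (n + 1) * T := by
        refine mul_le_mul_of_nonneg_right ?_ hT
        exact_mod_cast h1

theorem measurableSet_selectedClusters (n : ℕ) (p : Finset (Lattice L) → Prop)
    (𝒦 : Finset (Finset (Lattice L))) :
    MeasurableSet[edgeSigma (⋃ x ∈ box (n + 1) (0 : Lattice L), innerEdges n x)]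
      {ω | selectedClusters n p ω = 𝒦} := by
  refine measurableSet_of_determined ?_ fun ω ω' h hω => ?_
  · exact Set.Finite.biUnion (Finset.finite_toSet _) fun x _ => innerEdges_finite n x
  have hcl : ∀ x ∈ box (n + 1) (0 : Lattice L), cl n ω x = cl n ω' x := fun x hx =>
    cl_congr fun e he => h e (Set.mem_iUnion₂.2 ⟨x, hx, he⟩)
  have : selectedClusters n p ω = selectedClusters n p ω' := by
    classical
    have hsel : selected n p ω = selected n p ω' := by
      ext x
      rw [mem_selected, mem_selected]
      exact and_congr_right fun hx => by rw [hcl x (mem_box.2 hx)]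
    rw [selectedClusters, selectedClusters, ← hsel]
    refine Finset.image_congr fun x hx => hcl x (mem_box.2 ?_)
    exact (mem_selected.1 hx).1
  exact this.symm.trans hω

open Classical in
/-- The selected clusters can be split into two classes with at least `a` pairs of vertices in
different `n`-blocks, all the corresponding edges being closed. -/
def closedCut (n : ℕ) (p : Finset (Lattice L) → Prop) (a : ℝ) : Set (Config L) :=
  {ω | ∃ 𝒮 ⊆ selectedClusters n p ω,
    a ≤ (crossPairs n (𝒮.biUnion id) ((selectedClusters n p ω \ 𝒮).biUnion id)).card ∧
    ω ∈ allClosed (Set.range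
      (crossEdge n (𝒮.biUnion id) ((selectedClusters n p ω \ 𝒮).biUnion id)))}

/-- Condition on the family of selected clusters. It has at most 2^b ≤ e^b splittings, and each
admissible one is closed with probability at most e^(-w_n a). -/
theorem law_closedCut_le (hL : 2 ≤ L) {J : Kernel L} (hiso : J.IsometryInvariant) {n : ℕ}
    {p : Finset (Lattice L) → Prop} {b : ℝ} (hb : ∀ ω, ((selectedClusters n p ω).card : ℝ) ≤ b)
    (a : ℝ) : J.law.real (closedCut n p a) ≤ Real.exp (b - J.weight n * a) := by
  classical
  set 𝔎 : Finset (Finset (Finset (Lattice L))) :=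
    (box (n + 1) 0).powerset.powerset.filter fun 𝒦 =>
      (𝒦.card : ℝ) ≤ b ∧ (𝒦 : Set (Finset (Lattice L))).PairwiseDisjoint id with h𝔎
  have hmem : ∀ ω, selectedClusters n p ω ∈ 𝔎 := fun ω =>
    Finset.mem_filter.2 ⟨Finset.mem_powerset.2 fun K hK => Finset.mem_powerset.2
      (subset_box_of_mem_selectedClusters hK), hb ω, pairwiseDisjoint_selectedClusters n p ω⟩
  let A : Finset (Finset (Lattice L)) → Finset (Finset (Lattice L)) → Set (Config L) :=
    fun 𝒦 𝒮 => {ω | selectedClusters n p ω = 𝒦} ∩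
      allClosed (Set.range (crossEdge n (𝒮.biUnion id) ((𝒦 \ 𝒮).biUnion id)))
  let good : Finset (Finset (Lattice L)) → Finset (Finset (Finset (Lattice L))) := fun 𝒦 =>
    𝒦.powerset.filter fun 𝒮 =>
      a ≤ (crossPairs n (𝒮.biUnion id) ((𝒦 \ 𝒮).biUnion id)).card
  have hcover : closedCut n p a ⊆ ⋃ 𝒦 ∈ 𝔎, ⋃ 𝒮 ∈ good 𝒦, A 𝒦 𝒮 := by
    rintro ω ⟨𝒮, h𝒮, ha, hω⟩
    exact Set.mem_iUnion₂.2 ⟨_, hmem ω, Set.mem_iUnion₂.2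
      ⟨𝒮, Finset.mem_filter.2 ⟨Finset.mem_powerset.2 h𝒮, ha⟩, rfl, hω⟩⟩
  have hA : ∀ 𝒦 ∈ 𝔎, ∀ 𝒮 ∈ good 𝒦, J.law.real (A 𝒦 𝒮) ≤
      J.law.real {ω | selectedClusters n p ω = 𝒦} * Real.exp (-(J.weight n * a)) := by
    intro 𝒦 h𝒦 𝒮 h𝒮
    obtain ⟨h𝒦1, _, h𝒦2⟩ := Finset.mem_filter.1 h𝒦
    obtain ⟨h𝒮1, h𝒮2⟩ := Finset.mem_filter.1 h𝒮
    rw [Finset.mem_powerset] at h𝒦1 h𝒮1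
    have hsub : ∀ 𝒯 ⊆ 𝒦, 𝒯.biUnion id ⊆ box (n + 1) 0 := fun 𝒯 h𝒯 =>
      Finset.biUnion_subset.2 fun K hK => Finset.mem_powerset.1 (h𝒦1 (h𝒯 hK))
    rw [law_real_inter J (disjoint_innerEdges_crossEdge n _ _ (box (n + 1) 0))
      (measurableSet_selectedClusters n p 𝒦) (measurableSet_allClosed _),
      law_allClosed_crossEdge hL hiso (hsub 𝒮 h𝒮1) (hsub _ Finset.sdiff_subset)
        (disjoint_biUnion_sdiff h𝒦2 h𝒮1)]
    refine mul_le_mul_of_nonneg_left (Real.exp_le_exp.2 (neg_le_neg ?_)) measureReal_nonneg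
    exact mul_le_mul_of_nonneg_left h𝒮2 (NNReal.coe_nonneg _)
  have hcard : ∀ 𝒦 ∈ 𝔎, ((good 𝒦).card : ℝ) ≤ Real.exp b := by
    intro 𝒦 h𝒦
    have h1 : (good 𝒦).card ≤ 2 ^ 𝒦.card :=
      (Finset.card_filter_le _ _).trans (Finset.card_powerset 𝒦).le
    have h2 : (2 : ℝ) ^ 𝒦.card ≤ Real.exp 1 ^ 𝒦.card :=
      pow_le_pow_left₀ zero_le_two (by linarith [Real.add_one_le_exp 1]) _
    rw [← Real.exp_nat_mul, mul_one] at h2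
    exact (by exact_mod_cast h1 : ((good 𝒦).card : ℝ) ≤ (2 : ℝ) ^ 𝒦.card).trans
      (h2.trans (Real.exp_le_exp.2 (Finset.mem_filter.1 h𝒦).2.1))
  have htotal : ∑ 𝒦 ∈ 𝔎, J.law.real {ω | selectedClusters n p ω = 𝒦} ≤ 1 := by
    rw [← measureReal_biUnion_finset]
    · exact measureReal_le_one
    · intro 𝒦 _ 𝒦' _ hne
      rw [Function.onFun, Set.disjoint_left]
      intro ω h h'
      exact hne (h.symm.trans h')
    · exact fun 𝒦 _ => edgeSigma_le _ _ (measurableSet_selectedClusters n p 𝒦)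
  calc J.law.real (closedCut n p a)
      ≤ ∑ 𝒦 ∈ 𝔎, J.law.real (⋃ 𝒮 ∈ good 𝒦, A 𝒦 𝒮) :=
        (measureReal_mono hcover (measure_ne_top _ _)).trans (measureReal_biUnion_finset_le _ _)
    _ ≤ ∑ 𝒦 ∈ 𝔎, ∑ 𝒮 ∈ good 𝒦,
          J.law.real {ω | selectedClusters n p ω = 𝒦} * Real.exp (-(J.weight n * a)) :=
        Finset.sum_le_sum fun 𝒦 h𝒦 => (measureReal_biUnion_finset_le _ _).trans
          (Finset.sum_le_sum (hA 𝒦 h𝒦))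
    _ ≤ ∑ 𝒦 ∈ 𝔎, J.law.real {ω | selectedClusters n p ω = 𝒦} *
          Real.exp (b - J.weight n * a) := by
        refine Finset.sum_le_sum fun 𝒦 h𝒦 => ?_
        rw [Finset.sum_const, nsmul_eq_mul, sub_eq_add_neg, Real.exp_add, mul_left_comm]
        refine mul_le_mul_of_nonneg_left ?_ measureReal_nonneg
        exact mul_le_mul_of_nonneg_right (hcard 𝒦 h𝒦) (Real.exp_pos _).le
    _ ≤ Real.exp (b - J.weight n * a) := by
        rw [← Finset.sum_mul]
        exact mul_le_of_le_one_left (Real.exp_pos _).le htotal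

end Cut

/-! ### From the absence of a closed cut to a giant cluster -/

section Giant

/-- If no class of an equivalence relation on a finite set `G` fills `G` up to `c` elements, then
`G` is a disjoint union of two saturated sets with at least `c` elements each. -/
theorem exists_balanced_saturated {α : Type*} [DecidableEq α] (r : Setoid α) [DecidableRel r]
    (G : Finset α) {c : ℝ} (hc : 0 < c) (hG : 3 * c ≤ G.card)
    (hclass : ∀ x ∈ G, ((G.filter fun y => r x y).card : ℝ) < G.card - c) :
    ∃ U ⊆ G, (∀ x ∈ U, ∀ y ∈ G, r x y → y ∈ U) ∧ c ≤ U.card ∧ c ≤ (G \ U).card := by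
  classical
  set F := G.powerset.filter fun U => (∀ x ∈ U, ∀ y ∈ G, r x y → y ∈ U) ∧ c ≤ (U.card : ℝ) with hF
  have hne : F.Nonempty := ⟨G, Finset.mem_filter.2
    ⟨Finset.mem_powerset_self G, fun _ _ y hy _ => hy, by linarith⟩⟩
  -- Take U saturated with at least c elements and of minimal size, and let D be a class inside U.
  -- By minimality |U \ D| < c. If |D| ≥ c then |U| ≤ |D| and the hypothesis on classes applies;
  -- otherwise |U| < 2c and |G| ≥ 3c suffices.
  obtain ⟨U, hU, hmin⟩ := F.exists_min_image Finset.card hne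
  obtain ⟨hUG, hsat, hcU⟩ := Finset.mem_filter.1 hU
  rw [Finset.mem_powerset] at hUG
  have hsd : ((G \ U).card : ℝ) = G.card - U.card := by
    rw [Finset.card_sdiff_of_subset hUG, Nat.cast_sub (Finset.card_le_card hUG)]
  refine ⟨U, hUG, hsat, hcU, ?_⟩
  have hUpos : 0 < U.card := by
    have : (0 : ℝ) < U.card := by linarith
    exact_mod_cast this
  obtain ⟨x, hx⟩ := Finset.card_pos.1 hUpos
  set D := G.filter fun y => r x y with hD
  have hxD : x ∈ D := Finset.mem_filter.2 ⟨hUG hx, r.refl x⟩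
  have hDU : D ⊆ U := fun y hy => hsat x hx y (Finset.mem_filter.1 hy).1 (Finset.mem_filter.1 hy).2
  have hDlt := hclass x (hUG hx)
  have hsplit : ((U \ D).card : ℝ) = U.card - D.card := by
    rw [Finset.card_sdiff_of_subset hDU, Nat.cast_sub (Finset.card_le_card hDU)]
  have hrest : ((U \ D).card : ℝ) < c := by
    by_contra hge
    rw [not_lt] at hge
    have hmem : U \ D ∈ F := by
      refine Finset.mem_filter.2 ⟨Finset.mem_powerset.2 (Finset.sdiff_subset.trans hUG), ?_, hge⟩
      intro a ha b hb hab
      rw [Finset.mem_sdiff] at ha ⊢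
      refine ⟨hsat a ha.1 b hb hab, fun hbD => ha.2 ?_⟩
      exact Finset.mem_filter.2 ⟨hUG ha.1, r.trans (Finset.mem_filter.1 hbD).2 (r.symm hab)⟩
    have hlt : (U \ D).card < U.card :=
      Finset.card_lt_card (Finset.ssubset_iff_subset_ne.2 ⟨Finset.sdiff_subset, fun he =>
        (Finset.mem_sdiff.1 (he.symm ▸ hx : x ∈ U \ D)).2 hxD⟩)
    exact absurd (hmin _ hmem) (not_le.2 hlt)
  by_cases hDc : c ≤ (D.card : ℝ)
  · have hmem : D ∈ F := by
      refine Finset.mem_filter.2 ⟨Finset.mem_powerset.2 (Finset.filter_subset _ _), ?_, hDc⟩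
      intro a ha b hb hab
      exact Finset.mem_filter.2 ⟨hb, r.trans (Finset.mem_filter.1 ha).2 hab⟩
    have : (U.card : ℝ) ≤ D.card := by exact_mod_cast hmin D hmem
    rw [hsd]
    linarith
  · rw [hsd]
    linarith

variable {L : ℕ} [NeZero L]

/-- By pigeonhole U and T each have at least c / L points in some child block. If it is the same
child for both, any other child holds at least 2c points of U and T together, so one of the two has
at least c / L points there. -/
theorem sq_le_card_crossPairs (hL : 2 ≤ L) {n : ℕ} {U T : Finset (Lattice L)} {c : ℝ}
    (hU : c ≤ U.card) (hT : c ≤ T.card) (hc : 0 ≤ c)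
    (hUT : ∀ i : ZMod L, 2 * c ≤ (U.filter fun x => x n = i).card +
      (T.filter fun x => x n = i).card) :
    (c / L) ^ 2 ≤ (crossPairs n U T).card := by
  have hLpos : (0 : ℝ) < L := Nat.cast_pos.2 (NeZero.pos L)
  have hcL : c / L ≤ c := div_le_self hc (by exact_mod_cast NeZero.one_le)
  have : Nontrivial (ZMod L) := by
    have : Fact (1 < L) := ⟨hL⟩
    infer_instance
  have hcross : ∀ i j : ZMod L, i ≠ j → c / L ≤ (U.filter fun x => x n = i).card →
      c / L ≤ (T.filter fun x => x n = j).card → (c / L) ^ 2 ≤ (crossPairs n U T).card := by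
    intro i j hij h1 h2
    have hsub : (U.filter fun x => x n = i) ×ˢ (T.filter fun x => x n = j) ⊆
        crossPairs n U T := by
      rintro ⟨u, v⟩ huv
      simp only [Finset.mem_product, Finset.mem_filter] at huv
      refine mem_crossPairs.2 ⟨⟨huv.1.1, huv.2.1⟩, fun h => hij ?_⟩
      rw [← huv.1.2, ← huv.2.2]
      exact h n le_rfl
    have hle := Finset.card_le_card hsub
    rw [Finset.card_product] at hle
    calc (c / L) ^ 2 = (c / L) * (c / L) := sq _
      _ ≤ (U.filter fun x => x n = i).card * (T.filter fun x => x n = j).card :=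
          mul_le_mul h1 h2 (by positivity) (by positivity)
      _ ≤ _ := by exact_mod_cast hle
  have hpigeon : ∀ S : Finset (Lattice L), c ≤ S.card →
      ∃ i : ZMod L, c / L ≤ (S.filter fun x => x n = i).card := by
    intro S hS
    by_contra! hcon
    have h1 : (S.card : ℝ) = ∑ i : ZMod L, ((S.filter fun x => x n = i).card : ℝ) := by
      exact_mod_cast Finset.card_eq_sum_card_fiberwise (f := fun x : Lattice L => x n)
        (t := Finset.univ) fun _ _ => Finset.mem_coe.2 (Finset.mem_univ _)
    have h2 : ∑ i : ZMod L, ((S.filter fun x => x n = i).card : ℝ) < ∑ i : ZMod L, c / L :=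
      Finset.sum_lt_sum_of_nonempty Finset.univ_nonempty fun i _ => hcon i
    rw [Finset.sum_const, Finset.card_univ, ZMod.card, nsmul_eq_mul,
      mul_div_cancel₀ _ hLpos.ne'] at h2
    linarith
  obtain ⟨i, hi⟩ := hpigeon U hU
  obtain ⟨j, hj⟩ := hpigeon T hT
  by_cases hij : i = j
  · subst hij
    obtain ⟨k, hk⟩ := exists_ne i
    by_cases hUk : c / L ≤ (U.filter fun x => x n = k).card
    · exact hcross k i hk hUk hj
    · refine hcross i k hk.symm hi ?_
      linarith [hUT k]
  · exact hcross i j hij hi hj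

open Classical in
theorem filter_box_single_subset {n : ℕ} (p : Finset (Lattice L) → Prop) (ω : Config L)
    (i : ZMod L) : (box n (Finsupp.single n i)).filter (fun x => p (cl n ω x)) ⊆
      (selected n p ω).filter fun x => x n = i := by
  intro x hx
  rw [Finset.mem_filter, mem_box] at hx
  refine Finset.mem_filter.2 ⟨mem_selected.2 ⟨?_, hx.2⟩, ?_⟩
  · exact (near_single n i).trans (hx.1.mono n.le_succ)
  · rw [← hx.1 n le_rfl]
    simp

open Classical in
theorem mul_le_card_selected {n : ℕ} (p : Finset (Lattice L) → Prop) (ω : Config L) {d : ℝ}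
    (hd : ∀ i : ZMod L, d ≤
      ((box n (Finsupp.single n i)).filter fun x => p (cl n ω x)).card) :
    L * d ≤ (selected n p ω).card := by
  have h1 : ((selected n p ω).card : ℝ) =
      ∑ i : ZMod L, (((selected n p ω).filter fun x => x n = i).card : ℝ) := by
    exact_mod_cast Finset.card_eq_sum_card_fiberwise (f := fun x : Lattice L => x n)
      (t := Finset.univ) fun _ _ => Finset.mem_coe.2 (Finset.mem_univ _)
  have h2 : ∑ _i : ZMod L, d ≤
      ∑ i : ZMod L, (((selected n p ω).filter fun x => x n = i).card : ℝ) :=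
    Finset.sum_le_sum fun i _ => (hd i).trans
      (by exact_mod_cast Finset.card_le_card (filter_box_single_subset p ω i))
  rw [Finset.sum_const, Finset.card_univ, ZMod.card, nsmul_eq_mul] at h2
  exact h2.trans h1.ge

open Classical in
/-- Off the event `closedCut`, if every `n`-block in the `(n + 1)`-block of the origin contains
many selected vertices, then nearly all selected vertices are in one cluster. -/
theorem exists_cl_of_notMem_closedCut (hL : 2 ≤ L) {n : ℕ} {p : Finset (Lattice L) → Prop}
    {ω : Config L} {c : ℝ} (hc : 0 < c) (hω : ω ∉ closedCut n p ((c / L) ^ 2))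
    (hblock : ∀ i : ZMod L, 3 * c ≤
      ((box n (Finsupp.single n i)).filter fun x => p (cl n ω x)).card) :
    ∃ x, Near (n + 1) 0 x ∧ ((selected n p ω).card : ℝ) - c ≤ (cl (n + 1) ω x).card := by
  by_contra! hcon
  set G := selected n p ω with hGdef
  have hfib : ∀ i : ZMod L, (box n (Finsupp.single n i)).filter (fun x => p (cl n ω x)) ⊆
      G.filter fun x => x n = i := filter_box_single_subset p ω
  have hG3 : 3 * c ≤ G.card := by
    refine (hblock 0).trans ?_
    exact_mod_cast Finset.card_le_card ((hfib 0).trans (Finset.filter_subset _ _))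
  obtain ⟨U, hUG, hsat, hcU, hcT⟩ := exists_balanced_saturated
    (shortGraph (n + 1) ω).reachableSetoid G hc hG3 (by
      intro x hx
      refine lt_of_le_of_lt ?_ (hcon x (mem_selected.1 hx).1)
      exact_mod_cast Finset.card_le_card fun y hy => mem_cl.2 (Finset.mem_filter.1 hy).2)
  -- Selection depends only on the cluster, so G, and with it U and G \ U, is a union of n-block
  -- clusters.
  have hclG : ∀ x ∈ G, cl n ω x ⊆ G := by
    intro x hx y hy
    have hr := mem_cl.1 hy
    obtain ⟨h1, h2⟩ := mem_selected.1 hx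
    refine mem_selected.2 ⟨h1.trans ((near_of_reachable hr).mono n.le_succ), ?_⟩
    rwa [← cl_eq_of_reachable hr]
  have hclU : ∀ x ∈ U, cl n ω x ⊆ U := fun x hx y hy =>
    hsat x hx y (hclG x (hUG hx) hy) (mem_cl.1 (cl_mono n.le_succ ω x hy))
  have hU : (U.image (cl n ω)).biUnion id = U := by
    ext y
    simp only [Finset.mem_biUnion, Finset.mem_image, id]
    constructor
    · rintro ⟨_, ⟨x, hx, rfl⟩, hy⟩
      exact hclU x hx hy
    · exact fun hy => ⟨_, ⟨y, hy, rfl⟩, self_mem_cl n ω y⟩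
  have hT : (selectedClusters n p ω \ U.image (cl n ω)).biUnion id = G \ U := by
    ext y
    simp only [Finset.mem_biUnion, Finset.mem_sdiff, mem_selectedClusters, Finset.mem_image, id]
    constructor
    · rintro ⟨_, ⟨⟨x, hx, rfl⟩, hxU⟩, hy⟩
      refine ⟨hclG x hx hy, fun hyU => hxU ⟨y, hyU, ?_⟩⟩
      exact (cl_eq_of_reachable (mem_cl.1 hy)).symm
    · rintro ⟨hy, hyU⟩
      refine ⟨_, ⟨⟨y, hy, rfl⟩, ?_⟩, self_mem_cl n ω y⟩
      rintro ⟨x, hx, he⟩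
      exact hyU (hclU x hx (he ▸ self_mem_cl n ω y))
  refine hω ⟨U.image (cl n ω), ?_, ?_⟩
  · intro K hK
    obtain ⟨x, hx, rfl⟩ := Finset.mem_image.1 hK
    exact mem_selectedClusters.2 ⟨x, hUG hx, rfl⟩
  rw [hU, hT]
  constructor
  · refine sq_le_card_crossPairs hL hcU hcT hc.le fun i => ?_
    have h1 : (G.filter fun x => x n = i).card ≤
        (U.filter fun x => x n = i).card + ((G \ U).filter fun x => x n = i).card := by
      refine le_trans (Finset.card_le_card fun x hx => ?_) (Finset.card_union_le _ _)
      rw [Finset.mem_filter] at hx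
      simp only [Finset.mem_union, Finset.mem_filter, Finset.mem_sdiff]
      tauto
    have h2 := Finset.card_le_card (hfib i)
    have h3 : (((box n (Finsupp.single n i)).filter fun x => p (cl n ω x)).card : ℝ) ≤
      (U.filter fun x => x n = i).card + ((G \ U).filter fun x => x n = i).card := by
      exact_mod_cast h2.trans h1
    linarith [hblock i]
  -- An open edge from U to G \ U would join its endpoints inside the (n+1)-block, against
  -- saturation of U.
  · rintro _ ⟨⟨⟨u, v⟩, hp⟩, rfl⟩
    obtain ⟨⟨hu, hv⟩, hn⟩ := mem_crossPairs.1 hp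
    obtain ⟨hvG, hvU⟩ := Finset.mem_sdiff.1 hv
    by_contra hopen
    rw [Bool.not_eq_false] at hopen
    refine hvU (hsat u hu v hvG (SimpleGraph.Adj.reachable ⟨⟨ne_of_not_near hn, hopen⟩, ?_⟩))
    exact (mem_selected.1 (hUG hu)).1.symm.trans (mem_selected.1 hvG).1

end Giant

/-! ### Choice of constants and conclusion -/

section Main

variable {L : ℕ} [NeZero L]

/-- Every vertex of the shell between Λ_n and Λ_(n+1) has weight w_n, and there are at most L^(n+1)
of them. -/
theorem Kernel.exists_tail_le (hL : 2 ≤ L) {J : Kernel L} (hiso : J.IsometryInvariant)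
    (hreg : J.IsRegular) :
    ∃ C : ℝ≥0, 0 < C ∧ ∀ᶠ n in atTop, J.tail n ≤ C * (L ^ (n + 1) * J.weight n) := by
  obtain ⟨C, hC⟩ := hreg
  -- The constant is made positive because M and κ are later built by multiplying and dividing by
  -- it.
  refine ⟨C + 1, by positivity, ?_⟩
  filter_upwards [hC] with n hn
  have h1 : J.tail n = ∑' x : {x : Lattice L // x ∉ block L n}, (J.pair 0 x.1 : ℝ≥0∞) := by
    exact (Equiv.subtypeEquivRight fun x => not_congr (mem_block_iff (n := n) (y := x) hL)).tsum_eq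
      (fun y => (J.pair 0 y.1 : ℝ≥0∞)) |>.symm
  have h2 : ∑' x : {x : Lattice L // x ∈ block L (n + 1) \ block L n}, (J.pair 0 x.1 : ℝ≥0∞) ≤
      L ^ (n + 1) * J.weight n := by
    have hw : ∀ x : {x : Lattice L // x ∈ block L (n + 1) \ block L n},
        (J.pair 0 x.1 : ℝ≥0∞) = J.weight n := by
      rintro ⟨x, hx, hx'⟩
      rw [mem_block_iff hL] at hx hx'
      rw [J.pair_of_ne (ne_of_not_near hx'), J.eq_weight hL hiso hx' hx]
    rw [tsum_congr hw, ENNReal.tsum_const]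
    refine mul_le_mul_left ?_ _
    have h3 : Set.encard (block L (n + 1) \ block L n) ≤ (L ^ (n + 1) : ℕ) := by
      rw [← card_box (n + 1) (0 : Lattice L), ← Set.encard_coe_eq_coe_finsetCard, coe_box hL]
      exact Set.encard_le_encard Set.sdiff_subset
    calc ((ENat.card {x : Lattice L // x ∈ block L (n + 1) \ block L n} : ℕ∞) : ℝ≥0∞)
        ≤ (((L ^ (n + 1) : ℕ) : ℕ∞) : ℝ≥0∞) := by exact_mod_cast h3
      _ = _ := by push_cast; rfl
  rw [h1]
  refine hn.trans (mul_le_mul' ?_ h2)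
  exact_mod_cast le_add_of_nonneg_right (zero_le_one' ℝ≥0)

/-- The exponents in `law_closedCut_le` for clusters that send out at least
`2 * C * L ^ 4 / η ^ 2` edges on average. -/
theorem cut_exponent_le {L C T w η W : ℝ} (hL : 0 < L) (hC : 0 < C) (hη : 0 < η) (hW : 0 < W)
    (hT : T ≤ C * (W * L * w)) :
    W * L * T / (2 * C * L ^ 4 / η ^ 2) - w * (η * W / L) ^ 2 ≤
      -(η ^ 2 / (2 * C * L ^ 3) * (W * T)) := by
  have h1 : W * L * T / (2 * C * L ^ 4 / η ^ 2) = η ^ 2 / (2 * C * L ^ 3) * (W * T) := by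
    field_simp
  have h2 : w * (η * W / L) ^ 2 =
      η ^ 2 / (2 * C * L ^ 3) * (W * (2 * (C * (W * L * w)))) := by
    field_simp
  rw [h1, h2, ← mul_sub, ← mul_neg]
  refine mul_le_mul_of_nonneg_left ?_ (by positivity)
  nlinarith

theorem eventually_le_law_maxClusterSize (hL : 2 ≤ L) {J : Kernel L} (hiso : J.IsometryInvariant)
    (hreg : J.IsRegular) (hθ : 0 < J.theta) {ε δ : ℝ} (hε : 0 < ε) (hδ : 0 < δ) :
    ∀ᶠ n in atTop, 1 - δ ≤ J.law.real
      {ω | (J.theta - ε) * ((block L (n + 1)).ncard : ℝ) ≤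
        (maxClusterSize ω (block L (n + 1)) : ℝ)} := by
  classical
  have hLpos : (0 : ℝ) < L := Nat.cast_pos.2 (NeZero.pos L)
  have hL1 : (1 : ℝ) ≤ L := by exact_mod_cast (NeZero.one_le : 1 ≤ L)
  obtain ⟨C, hC, htail⟩ := J.exists_tail_le hL hiso hreg
  have hCpos : (0 : ℝ) < C := hC
  have hT : ∀ᶠ n in atTop, J.tail n ≠ ∞ := by
    filter_upwards [htail] with n hn
    refine ne_top_of_le_ne_top ?_ hn
    finiteness
  -- Capping at θ gives θ - ε₁ / 2 ≥ ε₁ / 2 = 3η, the 3c vertices per child block required by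
  -- `exists_cl_of_notMem_closedCut`.
  set ε₁ := min ε J.theta with hε₁
  have hε₁pos : 0 < ε₁ := lt_min hε hθ
  have hε₁ε : ε₁ ≤ ε := min_le_left _ _
  have hε₁θ : ε₁ ≤ J.theta := min_le_right _ _
  set η := ε₁ / 6 with hη
  have hηpos : 0 < η := by positivity
  -- With this M, regularity makes the entropy term L^(n+1) T_n / M equal to κ L^n T_n, at most half
  -- the energy term w_n (η L^n / L)^2.
  set M : ℝ := 2 * C * L ^ 4 / η ^ 2 with hM
  have hMpos : 0 < M := by positivity
  set κ : ℝ := η ^ 2 / (2 * C * L ^ 3) with hκ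
  have hκpos : 0 < κ := by positivity
  filter_upwards [htail, hT, eventually_le_pow_mul_tail hL hiso hT hθ (-Real.log (δ / 2) / κ),
    eventually_law_card_heavy_lt_le hL hiso hT hMpos.le (half_pos hε₁pos)
      (show 0 < δ / 2 / L by positivity)] with n hn hTn hgrow hheavy
  set T := (J.tail n).toReal with hTdef
  set p : Finset (Lattice L) → Prop := fun K => M < K.card * T with hp
  have hLn : (0 : ℝ) < (L : ℝ) ^ n := by positivity
  have hTle : T ≤ C * ((L : ℝ) ^ n * L * J.weight n) := by
    have := ENNReal.toReal_mono (by finiteness) hn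
    simpa [pow_succ] using this
  have hcut : J.law.real (closedCut n p ((η * L ^ n / L) ^ 2)) ≤ δ / 2 := by
    have hb : ∀ ω, ((selectedClusters n p ω).card : ℝ) ≤ (L : ℝ) ^ n * L * T / M := by
      intro ω
      rw [le_div_iff₀ hMpos, ← pow_succ]
      exact card_selectedClusters_mul_le ENNReal.toReal_nonneg ω
    refine (law_closedCut_le hL hiso hb _).trans ?_
    rw [← Real.le_log_iff_exp_le (by positivity)]
    refine (cut_exponent_le hLpos hCpos hηpos hLn hTle).trans ?_
    rw [div_le_iff₀ hκpos] at hgrow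
    linarith
  have hchild : J.law.real (⋃ i : ZMod L, {ω | (((box n (Finsupp.single n i)).filter fun x =>
      M < (cl n ω x).card * T).card : ℝ) < (J.theta - ε₁ / 2) * L ^ n}) ≤ δ / 2 := by
    refine (measureReal_iUnion_fintype_le _).trans ?_
    refine (Finset.sum_le_sum fun i _ => hheavy (Finsupp.single n i)).trans_eq ?_
    rw [Finset.sum_const, Finset.card_univ, ZMod.card, nsmul_eq_mul]
    field_simp
  have hcover : Set.univ ⊆ {ω | (J.theta - ε) * ((block L (n + 1)).ncard : ℝ) ≤
        (maxClusterSize ω (block L (n + 1)) : ℝ)} ∪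
      (closedCut n p ((η * L ^ n / L) ^ 2) ∪
      ⋃ i : ZMod L, {ω | (((box n (Finsupp.single n i)).filter fun x =>
        M < (cl n ω x).card * T).card : ℝ) < (J.theta - ε₁ / 2) * L ^ n}) := by
    intro ω _
    by_contra hcon
    simp only [Set.mem_union, Set.mem_iUnion, Set.mem_ofPred_eq, not_or, not_exists, not_lt,
      not_le] at hcon
    obtain ⟨hmax, hω, hblock⟩ := hcon
    obtain ⟨x, hx, hcard⟩ := exists_cl_of_notMem_closedCut hL (c := η * L ^ n) (by positivity) hω
      fun i => le_trans (by nlinarith) (hblock i)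
    -- The giant has at least (θ - ε₁ / 2) L^(n+1) - η L^n vertices, and ε₁ / 2 + η ≤ ε.
    have hsel := mul_le_card_selected p ω hblock
    have hle : ((cl (n + 1) ω x).card : ℝ) ≤ maxClusterSize ω (block L (n + 1)) := by
      exact_mod_cast card_cl_le_maxClusterSize hL ω hx
    rw [ncard_block hL, Nat.cast_pow, pow_succ] at hmax
    have h1 : η * (L : ℝ) ^ n ≤ η * (L ^ n * L) :=
      mul_le_mul_of_nonneg_left (le_mul_of_one_le_right hLn.le hL1) hηpos.le
    have h2 : (J.theta - ε) * ((L : ℝ) ^ n * L) ≤ (J.theta - ε₁ / 2 - η) * ((L : ℝ) ^ n * L) :=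
      mul_le_mul_of_nonneg_right (by linarith) (by positivity)
    nlinarith
  have hsmall := (measureReal_union_le (μ := J.law) _ _).trans (add_le_add hcut hchild)
  have htotal := (measureReal_mono hcover (measure_ne_top J.law _)).trans
    ((measureReal_union_le _ _).trans (add_le_add_right hsmall _))
  rw [probReal_univ] at htotal
  linarith

end Main

end HierPerc

end
theorem lemma3p1 (L : ℕ) (hL : 2 ≤ L) (J : HierPerc.Kernel L)
    (hiso : J.IsometryInvariant) (hint : J.IsIntegrable) (hreg : J.IsRegular)
    (hθ : 0 < J.theta) (ε : ℝ) (hε : 0 < ε) :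
    Tendsto
      (fun n : ℕ => J.law.real
        {ω | (J.theta - ε) * ((HierPerc.block L n).ncard : ℝ) ≤
          (HierPerc.maxClusterSize ω (HierPerc.block L n) : ℝ)})
      atTop (𝓝 1) := by
  have : NeZero L := ⟨by omega⟩
  -- The giant of Λ_(n+1) is assembled from clusters of n-blocks, so the estimate is naturally
  -- indexed by n + 1.
  rw [← tendsto_add_atTop_iff_nat 1]
  refine tendsto_order.2 ⟨fun a ha => ?_, fun a ha => Eventually.of_forall fun n =>
    measureReal_le_one.trans_lt ha⟩
  filter_upwards [HierPerc.eventually_le_law_maxClusterSize hL hiso hreg hθ hε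
    (half_pos (sub_pos.2 ha))] with n hn
  linarith
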